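/- Let $(\mathscr A,\varphi)$ be a $W^*$-probability space: $\mathscr A$ is a von Neumann algebra and $\varphi:\mathscr A\to\mathbb C$ is a unital, positive, faithful, tracial, normal (i.e. weakly continuous on norm-bounded sets) linear functional. A measure $\mu$ on $\mathbb R$ is the law of a self-adjoint $X\in\mathscr A$ if it is a Borel probability measure with $\int x^k\,\mu(dx)=\varphi(X^k)$ for all integers $k\ge0$. For $a\in\mathbb R$ and $v>0$, the semicircular distribution $S(a,v)$ has density $\frac1{2\pi v}\sqrt{4v-(x-a)^2}$ on $|x-a|\le 2\sqrt v$. Let $S=(S_t)_{t\ge0}$ be a free Brownian motion in $(\mathscr A,\varphi)$: self-adjoint elements of $\mathscr A$ with $S_0=0$, with $S_t-S_s$ of law $S(0,t-s)$ for $0\le s<t$, and with freely independent increments over successive intervals. For $n\ge1$, the Wigner integral $I_n^S$ is the $L^2$-isometric linear extension to $L^2(\mathbb R_+^n)$ (complex-valued functions) of the map $\mathbf 1_{(s_1,t_1]\times\cdots\times(s_n,t_n]}\mapsto (S_{t_1}-S_{s_1})\cdots(S_{t_n}-S_{s_n})$, where the intervals $(s_i,t_i]$ are pairwise disjoint and $\mathscr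 A$ carries the norm $\|X\|_2=\varphi(X^*X)^{1/2}$. Let $n\ge2$ and let $f\in L^2(\mathbb R_+^n)$ be nonzero and mirror symmetric, i.e. $f(t_1,\dots,t_n)=\overline{f(t_n,\dots,t_1)}$ for almost all $t_1,\dots,t_n\ge 0$. Then $I_n^S(f)$ is a well-defined self-adjoint element of $\mathscr A$ and $$\varphi\big[I_n^S(f)^4\big]>2\,\varphi\big[I_n^S(f)^2\big]^2 .$$ In particular, the law of $I_n^S(f)$ is not a semicircular distribution $S(a,v)$, for any $a\in\mathbb R$ and $v>0$. -/

import Mathlib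

open MeasureTheory Filter Topology
open scoped NNReal ENNReal ComplexOrder InnerProductSpace

noncomputable section

namespace FreeProb

/-- A (tracial) `W*`-probability space: a von Neumann algebra of operators on a Hilbert space `H`,
together with a unital, positive, faithful, tracial, weakly continuous linear functional.
Weak continuity is required in the usual (weakest) sense for functionals on von Neumann algebras:
continuity for the weak operator topology on norm-bounded sets, i.e. normality. -/
structure WStarProbabilitySpace (H : Type*) [NormedAddCommGroup H] [InnerProductSpace ℂ H]
    [CompleteSpace H] where
  algebra : VonNeumannAlgebra H
  φ : algebra.toStarSubalgebra →ₗ[ℂ] ℂ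
  map_one : φ 1 = 1
  nonneg : ∀ x, 0 ≤ φ (star x * x)
  faithful : ∀ x, φ (star x * x) = 0 → x = 0
  tracial : ∀ x y, φ (x * y) = φ (y * x)
  normal : ∀ (l : Filter algebra.toStarSubalgebra) (a : algebra.toStarSubalgebra) (r : ℝ),
    (∀ᶠ x in l, ‖x‖ ≤ r) →
    (∀ ξ η : H, Tendsto (fun x : algebra.toStarSubalgebra => ⟪ξ, (x : H →L[ℂ] H) η⟫_ℂ) l
      (𝓝 ⟪ξ, (a : H →L[ℂ] H) η⟫_ℂ)) →
    Tendsto φ l (𝓝 (φ a))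

variable {H : Type*} [NormedAddCommGroup H] [InnerProductSpace ℂ H] [CompleteSpace H]

/-- The von Neumann algebra of a `W*`-probability space, as a unital `*`-algebra. -/
abbrev WStarProbabilitySpace.Alg (P : WStarProbabilitySpace H) :
    StarSubalgebra ℂ (H →L[ℂ] H) :=
  P.algebra.toStarSubalgebra

/-- The norm `‖X‖₂ = φ(X* X)^{1/2}` of the noncommutative `L²`-space. -/
def WStarProbabilitySpace.norm₂ (P : WStarProbabilitySpace H) (X : P.Alg) : ℝ :=
  √(P.φ (star X * X)).re

/-- Free independence of a family of unital subalgebras: `φ(x₀ x₁ ⋯ xₘ) = 0` whenever the `xⱼ`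
are centred and neighbouring factors are taken from subalgebras with different indices. -/
def FreeSubalgebras (P : WStarProbabilitySpace H) {ι : Type*} (B : ι → Subalgebra ℂ P.Alg) :
    Prop :=
  ∀ (m : ℕ) (i : Fin (m + 1) → ι) (x : Fin (m + 1) → P.Alg),
    (∀ j : Fin m, i j.castSucc ≠ i j.succ) →
    (∀ j, x j ∈ B (i j)) →
    (∀ j, P.φ (x j) = 0) →
    P.φ (List.ofFn x).prod = 0

/-- Free independence of a family of elements: the unital algebras they generate are free. -/
def FreelyIndependent (P : WStarProbabilitySpace H) {ι : Type*} (X : ι → P.Alg) : Prop :=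
  FreeSubalgebras P fun i => Algebra.adjoin ℂ {X i}

/-- `μ` is the law of `X`: a probability measure on `ℝ` with the same moments as `X`. -/
structure IsLaw (P : WStarProbabilitySpace H) (X : P.Alg) (μ : Measure ℝ) : Prop where
  isProbabilityMeasure : IsProbabilityMeasure μ
  integrable : ∀ k : ℕ, Integrable (fun x : ℝ => x ^ k) μ
  moment : ∀ k : ℕ, ((∫ x, x ^ k ∂μ : ℝ) : ℂ) = P.φ (X ^ k)

/-- The semicircular distribution `S(a, v)` with mean `a` and variance `v > 0`, with density
`√(4v - (x - a)²) / (2πv)` on `|x - a| ≤ 2√v`. (The real square root vanishes elsewhere.) -/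
def semicircular (a v : ℝ) : Measure ℝ :=
  volume.withDensity fun x =>
    ENNReal.ofReal (1 / (2 * Real.pi * v) * √(4 * v - (x - a) ^ 2))

/-- Free Brownian motion: a family of self-adjoint elements starting at `0`, with semicircular and
freely independent increments. (For `t 0 = 0` the increments over `t 0 < ⋯ < t n` are
`S (t 1), S (t 2) - S (t 1), …, S (t n) - S (t (n-1))`.) -/
structure IsFreeBrownianMotion (P : WStarProbabilitySpace H) (S : ℝ≥0 → P.Alg) : Prop where
  isSelfAdjoint : ∀ t, IsSelfAdjoint (S t)
  zero : S 0 = 0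
  law_increment : ∀ s t : ℝ≥0, s < t →
    IsLaw P (S t - S s) (semicircular 0 ((t : ℝ) - (s : ℝ)))
  free_increments : ∀ (n : ℕ) (t : Fin (n + 1) → ℝ≥0), StrictMono t →
    FreelyIndependent P fun i : Fin n => S (t i.succ) - S (t i.castSucc)

/-- Lebesgue measure on `ℝ₊ⁿ`, as a measure on `ℝⁿ` concentrated on the orthant. -/
def orthantMeasure (n : ℕ) : Measure (Fin n → ℝ) :=
  volume.restrict (Set.Ici 0)

/-- The space `L²(ℝ₊ⁿ)` of complex square-integrable functions. -/
abbrev L2Orthant (n : ℕ) := Lp ℂ 2 (orthantMeasure n)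

/-- `f(t₁, …, tₙ) = conj (f(tₙ, …, t₁))` for almost all `t ∈ ℝ₊ⁿ`. -/
def MirrorSymmetric {n : ℕ} (f : L2Orthant n) : Prop :=
  ∀ᵐ t ∂orthantMeasure n, f t = starRingEnd ℂ (f fun i => t i.rev)

/-- An off-diagonal rectangle `∏ᵢ (sᵢ, tᵢ]` in `ℝ₊ⁿ`, with pairwise disjoint sides. -/
structure OffDiagonalRectangle (n : ℕ) where
  s : Fin n → ℝ≥0
  t : Fin n → ℝ≥0
  le : ∀ i, s i ≤ t i
  disjoint : Pairwise fun i j => Disjoint (Set.Ioc (s i) (t i)) (Set.Ioc (s j) (t j))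

/-- The rectangle as a subset of `ℝⁿ`. -/
def OffDiagonalRectangle.toSet {n : ℕ} (R : OffDiagonalRectangle n) : Set (Fin n → ℝ) :=
  Set.univ.pi fun i => Set.Ioc (R.s i : ℝ) (R.t i : ℝ)

/-- The off-diagonal step function `∑ c_R 1_R` given by a finite family of coefficients. -/
def stepFunction {n : ℕ} (p : OffDiagonalRectangle n →₀ ℂ) (x : Fin n → ℝ) : ℂ :=
  p.sum fun R c => R.toSet.indicator (fun _ => c) x

/-- The Wigner integral `∑ c_R (S_{t₁} - S_{s₁}) ⋯ (S_{tₙ} - S_{sₙ})` of `∑ c_R 1_R`. -/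
def stepIntegral (P : WStarProbabilitySpace H) (S : ℝ≥0 → P.Alg) {n : ℕ}
    (p : OffDiagonalRectangle n →₀ ℂ) : P.Alg :=
  p.sum fun R c => c • (List.ofFn fun i => S (R.t i) - S (R.s i)).prod

/-- `X` is the Wigner integral `Iₙˢ(f)`: there are off-diagonal step functions converging to `f` in
`L²(ℝ₊ⁿ)` whose integrals converge to `X` in the noncommutative `L²`-norm. This is the graph of
the `L²`-isometric extension of the integral from step functions to `L²(ℝ₊ⁿ)`, restricted to
those values that are (bounded) elements of the von Neumann algebra. -/
def IsWignerIntegral (P : WStarProbabilitySpace H) (S : ℝ≥0 → P.Alg) {n : ℕ}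
    (f : L2Orthant n) (X : P.Alg) : Prop :=
  ∃ p : ℕ → OffDiagonalRectangle n →₀ ℂ,
    Tendsto (fun k => eLpNorm (fun x => f x - stepFunction (p k) x) 2 (orthantMeasure n))
      atTop (𝓝 0) ∧
    Tendsto (fun k => P.norm₂ (X - stepIntegral P S (p k))) atTop (𝓝 0)

end FreeProb

end

/-! For a free family of standard semicircular elements the Wick products, defined by the recursion
that removes the contraction of two equal neighbouring letters, are orthonormal for `φ(x* y)`. Their
product is a sum over how many letters are contracted where the two words meet. On a partition, an
off-diagonal step function is a coefficient function `c` on words of length `n` in the normalized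
increments. Words with a repeated letter have coefficient zero, so the integral is the homogeneous
Wick polynomial `∑ c v • wick x v`.

Two facts follow from the product formula. The first is Haagerup's inequality, `‖I(p)‖ ≤ (n + 1)
‖p‖₂` in operator norm, uniformly in the partition (`norm_sum_words_le`). Together with the density
of off-diagonal step functions, it makes the integral of every `f` a bounded element, a norm limit
of step integrals, and it gives uniqueness. Since reversing and conjugating step functions
corresponds to taking adjoints, mirror symmetry gives self-adjointness.

The second is that `φ((X X*)²)` is the sum over `k = 0, …, n` of the squared Hilbert-Schmidt norms
of the `k`-fold contractions of `c` with its adjoint (`norm₂_mul_star_sq`). The terms `k = 0` and `k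
= n` each equal `‖c‖⁴`, which accounts for `2 φ(X X*)²`. For `n ≥ 2` the term `k = n - 1` is a
further one, the Gram matrix of the slices of `c` in the first variable. As `1_R` is a tensor
product, Cauchy-Schwarz bounds this term below by `|⟪1_R, p⟫|⁴ / ‖1_R‖⁴`, a bound independent of the
partition and stable under `L²` limits. Rectangles are total in `L²`, so some `R` has nonzero
overlap with `f ≠ 0`, and the inequality stays strict in the limit.

A semicircular law is then excluded: the integral has mean zero, and a centred semicircular element
satisfies `φ(X⁴) = 2 φ(X²)²`. -/

noncomputable section

namespace FreeProb

section

/-! ### Wick products and their contraction formula. -/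

section Wick

variable {ι A : Type*} [DecidableEq ι] [Ring A]

/-- The Wick product of a word in the letters `x i`. For standard semicircular free `x i` these are
the images of the canonical basis of the full Fock space. -/
def wick (x : ι → A) : List ι → A
  | [] => 1
  | [i] => x i
  | i :: j :: w => x i * wick x (j :: w) - if i = j then wick x w else 0

theorem wick_nil (x : ι → A) : wick x [] = 1 := by rw [wick]

theorem wick_singleton (x : ι → A) (i : ι) : wick x [i] = x i := by rw [wick]

theorem wick_cons_cons (x : ι → A) (i j : ι) (w : List ι) :
    wick x (i :: j :: w) = x i * wick x (j :: w) - if i = j then wick x w else 0 := by rw [wick]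

/-- Only the two letters at the junction can contract. For empty `a` this is the defining recursion;
otherwise the first letter of `a` is peeled off by that recursion, which calls on the two shorter
words. -/
theorem wick_append_mul_cons (x : ι → A) (i j : ι) (b : List ι) : ∀ a : List ι,
    wick x (a ++ [i]) * wick x (j :: b) =
      wick x (a ++ i :: j :: b) + if i = j then wick x a * wick x b else 0
  | [] => by
    simp [wick_singleton, wick_cons_cons, wick_nil]
  | [c] => by
    have h := wick_append_mul_cons x i j b []
    simp only [List.nil_append, wick_nil, one_mul] at h
    simp only [List.cons_append, List.nil_append, wick_cons_cons x c i, wick_singleton x c,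
      sub_mul, mul_assoc, h, wick_nil]
    split_ifs <;> simp [mul_add]
    all_goals abel
  | c :: d :: a => by
    have h₁ := wick_append_mul_cons x i j b (d :: a)
    have h₂ := wick_append_mul_cons x i j b a
    simp only [List.cons_append] at h₁ ⊢
    rw [wick_cons_cons, wick_cons_cons, wick_cons_cons, sub_mul, mul_assoc, h₁]
    split_ifs at * <;> simp [mul_add, sub_mul, mul_assoc, h₂]
    all_goals abel

theorem wick_append_pair (x : ι → A) (i j : ι) (a : List ι) :
    wick x (a ++ [i, j]) = wick x (a ++ [i]) * x j - if i = j then wick x a else 0 := by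
  have h := wick_append_mul_cons x i j [] a
  rw [wick_singleton, wick_nil, mul_one] at h
  rw [h, add_sub_cancel_right]

/-- The adjoint turns the recursion at the left end into the recursion at the right end, which is
`wick_append_pair`. -/
theorem star_wick [StarRing A] (x : ι → A) (hx : ∀ i, star (x i) = x i) : ∀ w : List ι,
    star (wick x w) = wick x w.reverse
  | [] => by simp [wick_nil]
  | [i] => by simp [wick_singleton, hx]
  | i :: j :: w => by
    have h₁ := star_wick x hx (j :: w)
    have h₂ := star_wick x hx w
    simp only [List.reverse_cons, List.append_assoc, List.cons_append, List.nil_append] at h₁ ⊢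
    rw [wick_append_pair, wick_cons_cons, star_sub, star_mul, h₁, hx]
    by_cases h : i = j
    · simp [h, h₂]
    · simp [h, Ne.symm h]

/-- Iterates the contraction at the junction. The left word is reversed so that contracting `k`
letters means that `v` and `w` share a prefix of length `k`. -/
theorem wick_reverse_mul (x : ι → A) : ∀ v w : List ι,
    wick x v.reverse * wick x w = ∑ k ∈ Finset.range (v.length + 1),
      if v.take k = w.take k then wick x ((v.drop k).reverse ++ w.drop k) else 0
  | [], w => by simp [wick_nil]
  | i :: v, [] => by
    rw [Finset.sum_range_succ', Finset.sum_eq_zero]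
    · simp [wick_nil]
    · intro k _; simp
  | i :: v, j :: w => by
    rw [List.length_cons, Finset.sum_range_succ', List.reverse_cons, wick_append_mul_cons,
      wick_reverse_mul x v w, add_comm]
    congr 1
    · by_cases h : i = j <;> simp [h]
    · simp

/-- If neighbouring letters are distinct, no contraction is needed. -/
theorem wick_eq_prod (x : ι → A) : ∀ w : List ι, w.IsChain (· ≠ ·) → wick x w = (w.map x).prod
  | [], _ => by simp [wick_nil]
  | [i], _ => by simp [wick_singleton]
  | i :: j :: w, h => by
    rw [List.isChain_cons_cons] at h
    rw [wick_cons_cons, if_neg h.1, sub_zero, wick_eq_prod x (j :: w) h.2]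
    simp

end Wick

/-! ### Sums over words and products of Wick polynomials. -/

section Words

variable (ι : Type*) [Fintype ι] [DecidableEq ι]

/-- The finite set of words of length `n`. -/
def words (n : ℕ) : Finset (List ι) :=
  Finset.univ.image (List.ofFn : (Fin n → ι) → List ι)

/-- The finite set of words of length less than `M`. -/
def wordsLT (M : ℕ) : Finset (List ι) :=
  (Finset.range M).biUnion (words ι)

variable {ι}

@[simp] theorem mem_words {n : ℕ} {w : List ι} : w ∈ words ι n ↔ w.length = n := by
  simp only [words, Finset.mem_image, Finset.mem_univ, true_and]
  constructor
  · rintro ⟨f, rfl⟩; simp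
  · rintro rfl; exact ⟨w.get, List.ofFn_get w⟩

@[simp] theorem mem_wordsLT {M : ℕ} {w : List ι} : w ∈ wordsLT ι M ↔ w.length < M := by
  simp [wordsLT]

theorem sum_words_ofFn {M : Type*} [AddCommMonoid M] (n : ℕ) (f : List ι → M) :
    ∑ w ∈ words ι n, f w = ∑ w : Fin n → ι, f (List.ofFn w) := by
  rw [words, Finset.sum_image]
  exact fun a _ b _ h => List.ofFn_injective h

theorem sum_words_zero {M : Type*} [AddCommMonoid M] (f : List ι → M) :
    ∑ w ∈ words ι 0, f w = f [] := by
  rw [sum_words_ofFn]; simp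

theorem sum_words_one {M : Type*} [AddCommMonoid M] (f : List ι → M) :
    ∑ w ∈ words ι 1, f w = ∑ i, f [i] := by
  rw [sum_words_ofFn]
  exact Fintype.sum_equiv (Equiv.funUnique (Fin 1) ι) _ _ fun w => by simp

theorem sum_words_reverse {M : Type*} [AddCommMonoid M] (n : ℕ) (f : List ι → M) :
    ∑ w ∈ words ι n, f w.reverse = ∑ w ∈ words ι n, f w :=
  Finset.sum_nbij' List.reverse List.reverse (by simp) (by simp) (by simp) (by simp) (by simp)

theorem sum_words_append {M : Type*} [AddCommMonoid M] (m n : ℕ) (f : List ι → M) :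
    ∑ w ∈ words ι (m + n), f w = ∑ a ∈ words ι m, ∑ b ∈ words ι n, f (a ++ b) := by
  rw [← Finset.sum_product']
  refine Finset.sum_nbij' (fun w => (w.take m, w.drop m)) (fun p => p.1 ++ p.2) ?_ ?_ ?_ ?_ ?_
  · simp +contextual
  · simp +contextual
  · simp
  · rintro ⟨a, b⟩ h
    simp only [Finset.mem_product, mem_words] at h
    simp [← h.1]
  · simp

theorem sum_wordsLT_append {M : Type*} [AddCommMonoid M] (k N : ℕ) (f : List ι → M) :
    ∑ w ∈ wordsLT ι N with k ≤ w.length, f w =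
      ∑ a ∈ words ι k, ∑ b ∈ wordsLT ι (N - k), f (a ++ b) := by
  rw [← Finset.sum_product']
  refine Finset.sum_nbij' (fun w => (w.take k, w.drop k)) (fun p => p.1 ++ p.2) ?_ ?_ ?_ ?_ ?_
  · intro w hw
    simp only [Finset.mem_filter, mem_wordsLT] at hw
    simp only [Finset.mem_product, mem_words, mem_wordsLT, List.length_take, List.length_drop]
    omega
  · rintro ⟨a, b⟩ h
    simp only [Finset.mem_product, mem_words, mem_wordsLT] at h
    simp only [Finset.mem_filter, mem_wordsLT, List.length_append]
    omega
  · simp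
  · rintro ⟨a, b⟩ h
    simp only [Finset.mem_product, mem_words] at h
    simp [← h.1]
  · simp

variable {A : Type*} [Ring A] [Algebra ℂ A]

/-- The product formula for Wick polynomials, the left factor being homogeneous. -/
theorem sum_wick_mul_sum_wick (x : ι → A) (n N : ℕ) (c d : List ι → ℂ) :
    (∑ v ∈ words ι n, c v • wick x v) * (∑ w ∈ wordsLT ι N, d w • wick x w) =
      ∑ k ∈ Finset.range (n + 1), ∑ a ∈ words ι (n - k), ∑ b ∈ wordsLT ι (N - k),
        (∑ u ∈ words ι k, c (a ++ u) * d (u.reverse ++ b)) • wick x (a ++ b) := by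
  have h : ∀ v ∈ words ι n, ∀ w, wick x v * wick x w = ∑ k ∈ Finset.range (n + 1),
      if v.reverse.take k = w.take k then
        wick x ((v.reverse.drop k).reverse ++ w.drop k) else 0 := by
    intro v hv w
    have := wick_reverse_mul x v.reverse w
    rwa [List.reverse_reverse, List.length_reverse, mem_words.1 hv] at this
  rw [Finset.sum_mul_sum]
  have h' : ∀ v ∈ words ι n, ∀ w ∈ wordsLT ι N, (c v • wick x v) * (d w • wick x w) =
      ∑ k ∈ Finset.range (n + 1), if v.reverse.take k = w.take k then
        (c v * d w) • wick x ((v.reverse.drop k).reverse ++ w.drop k) else 0 := by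
    intro v hv w _
    rw [smul_mul_smul_comm, h v hv w, Finset.smul_sum]
    simp_rw [smul_ite, smul_zero]
  rw [Finset.sum_congr rfl fun v hv => Finset.sum_congr rfl (h' v hv)]
  rw [Finset.sum_congr rfl fun v _ => Finset.sum_comm, Finset.sum_comm]
  refine Finset.sum_congr rfl fun k hk => ?_
  rw [Finset.mem_range] at hk
  obtain ⟨m, rfl⟩ : ∃ m, n = m + k := ⟨n - k, by omega⟩
  rw [sum_words_append, Nat.add_sub_cancel]
  refine Finset.sum_congr rfl fun a _ => ?_
  have h₂ : ∀ u ∈ words ι k, ∑ w ∈ wordsLT ι N,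
      (if (a ++ u).reverse.take k = w.take k then (c (a ++ u) * d w) •
        wick x (((a ++ u).reverse.drop k).reverse ++ w.drop k) else 0) =
      ∑ b ∈ wordsLT ι (N - k), (c (a ++ u) * d (u.reverse ++ b)) • wick x (a ++ b) := by
    intro u hu
    have hu' : u.reverse.length = k := by simpa using hu
    -- The prefix condition forces `w` to have at least `k` letters and to begin with `u.reverse`,
    -- leaving only its tail `b` free.
    rw [← Finset.sum_filter_of_ne (p := fun w => k ≤ w.length), sum_wordsLT_append,
      Finset.sum_eq_single u.reverse]
    · refine Finset.sum_congr rfl fun b _ => ?_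
      simp [← hu']
    · intro u' h' hne
      refine Finset.sum_eq_zero fun b _ => if_neg ?_
      rw [List.reverse_append, List.take_left' hu', List.take_left' (mem_words.1 h')]
      exact hne.symm
    · simp_all
    · intro w _ hw
      by_contra hk'
      refine hw (if_neg fun he => ?_)
      have := congrArg List.length he
      rw [List.reverse_append, List.take_left' hu', List.length_take, hu'] at this
      omega
  rw [Finset.sum_congr rfl h₂, Finset.sum_comm]
  simp_rw [Finset.sum_smul]

end Words

end

/-! ### Positive functionals, the operator norm and the `L²` structure. -/

section

/-- Polarization: `φ(y* y)` is real for `y = x + 1` and `y = x + i`, which compares imaginary and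
real parts respectively. -/
theorem map_star_of_nonneg {A : Type*} [Ring A] [StarRing A] [Algebra ℂ A] [StarModule ℂ A]
    (φ : A →ₗ[ℂ] ℂ) (nonneg : ∀ x, 0 ≤ φ (star x * x)) (x : A) :
    φ (star x) = starRingEnd ℂ (φ x) := by
  have im_eq : ∀ y, (φ (star y * y)).im = 0 := fun y => ((Complex.le_def.1 (nonneg y)).2).symm
  have h₁ := im_eq (x + 1)
  have h₂ := im_eq (x + Complex.I • 1)
  have h₃ := im_eq x
  have h₄ := im_eq 1
  rw [star_one, mul_one] at h₄
  simp only [star_add, star_one, add_mul, mul_add, mul_one, one_mul, map_add, Complex.add_im,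
    h₃, h₄, star_smul, smul_mul_assoc, mul_smul_comm, map_smul, smul_eq_mul, Complex.mul_im,
    Complex.mul_re, RCLike.star_def, Complex.conj_I, Complex.neg_re, Complex.neg_im, Complex.I_re,
    Complex.I_im] at h₁ h₂
  apply Complex.ext
  · rw [Complex.conj_re]; linarith
  · rw [Complex.conj_im]; linarith

/-- In a `C*`-algebra with a faithful positive functional, the norm of a self-adjoint element is
determined by the growth of its moments. -/
theorem norm_le_of_moments_le {A : Type*} [CStarAlgebra A] (φ : A →ₗ[ℂ] ℂ)
    (nonneg : ∀ x, 0 ≤ φ (star x * x)) (faithful : ∀ x, φ (star x * x) = 0 → x = 0)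
    (a : A) (ha : IsSelfAdjoint a) (C : ℝ) (hC : 0 ≤ C)
    (h : ∀ p : ℕ, (φ (a ^ (2 * p))).re ≤ C ^ (2 * p)) : ‖a‖ ≤ C := by
  refine le_of_forall_gt fun r hr => ?_
  by_contra! hra
  have hr0 : 0 < r := hC.trans_lt hr
  obtain ⟨C', hCC', hC'r⟩ := exists_between hr
  have hC'0 : 0 < C' := hC.trans_lt hCC'
  -- `g` vanishes exactly on `[-C', C']`, so `g(a) = 0` will confine the spectrum there, with `C' <
  -- r ≤ ‖a‖`.
  set g : ℝ → ℝ := fun t => max (|t| - C') 0 with hg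
  have hgc : Continuous g := by fun_prop
  have hsa : IsSelfAdjoint (cfc g a) := cfc_predicate g a
  set K : ℝ := ‖a‖ with hK
  have hK0 : 0 < K := hr0.trans_le hra
  have : Nontrivial A := nontrivial_of_ne a 0 (norm_pos_iff.1 hK0)
  have key : ∀ p : ℕ, (C' ^ p / K) ^ 2 * (φ (cfc g a * cfc g a)).re ≤ C ^ (2 * p) := by
    intro p
    -- `q²` is the gap in `(C'^p / K)² g² ≤ t^(2p)`, valid on the spectrum because `g ≤ K` there and
    -- `g = 0` unless `|t| ≥ C'`. Positivity of `φ(q(a)* q(a))` carries the pointwise inequality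
    -- over to `φ`.
    set q : ℝ → ℝ := fun t => √(t ^ (2 * p) - (C' ^ p / K) ^ 2 * (g t * g t)) with hq
    have hqc : Continuous q := by fun_prop
    have hq2 : ∀ t ∈ spectrum ℝ a, q t * q t + (C' ^ p / K) ^ 2 * (g t * g t) = t ^ (2 * p) := by
      intro t ht
      have htK : |t| ≤ K := by simpa using! spectrum.norm_le_norm_of_mem ht
      have hle : (C' ^ p / K) ^ 2 * (g t * g t) ≤ t ^ (2 * p) := by
        have h0 : 0 ≤ g t := le_max_right _ _
        have h1 : C' ^ p / K * g t ≤ |t| ^ p := by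
          rcases le_total |t| C' with h | h
          · have : g t = 0 := max_eq_right (by linarith)
            rw [this, mul_zero]; positivity
          · have hgK : g t ≤ K := max_le (by linarith) hK0.le
            calc C' ^ p / K * g t ≤ C' ^ p / K * K := by gcongr
              _ = C' ^ p := by field_simp
              _ ≤ |t| ^ p := by gcongr
        calc (C' ^ p / K) ^ 2 * (g t * g t) = (C' ^ p / K * g t) ^ 2 := by ring
          _ ≤ (|t| ^ p) ^ 2 := by gcongr
          _ = t ^ (2 * p) := by rw [← pow_mul, mul_comm, pow_mul, sq_abs, ← pow_mul]
      rw [hq]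
      dsimp only
      rw [Real.mul_self_sqrt (by linarith)]
      ring
    have hsq : IsSelfAdjoint (cfc q a) := cfc_predicate q a
    have heq : a ^ (2 * p) = star (cfc q a) * cfc q a +
        ((((C' ^ p / K) ^ 2 : ℝ) : ℂ) • (cfc g a * cfc g a)) := by
      rw [hsq.star_eq, Complex.coe_smul, ← cfc_mul q q a, ← cfc_mul g g a,
        ← cfc_smul ((C' ^ p / K) ^ 2) (fun t => g t * g t) a, ← cfc_add (hf := by fun_prop)
          (hg := by fun_prop), ← cfc_pow_id (R := ℝ) a (2 * p)]
      exact (cfc_congr fun t ht => (hq2 t ht).symm)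
    have h1 := h p
    have h2 := (Complex.le_def.1 (nonneg (cfc q a))).1
    rw [heq, map_add, map_smul, Complex.add_re, smul_eq_mul, Complex.re_ofReal_mul] at h1
    simp only [Complex.zero_re] at h2
    linarith
  have hφ0 : (φ (cfc g a * cfc g a)).re ≤ 0 := by
    -- The bound on `φ(g(a)²)` is `K² (C / C')^(2p)`, which tends to zero since `C < C'`.
    have hlim : Tendsto (fun p : ℕ => K ^ 2 * ((C / C') ^ 2) ^ p) atTop (𝓝 (K ^ 2 * 0)) := by
      refine (tendsto_pow_atTop_nhds_zero_of_lt_one (by positivity) ?_).const_mul _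
      have : C / C' < 1 := (div_lt_one hC'0).2 hCC'
      have : 0 ≤ C / C' := by positivity
      nlinarith
    rw [mul_zero] at hlim
    refine ge_of_tendsto' hlim fun p => ?_
    have := key p
    have e : K ^ 2 * ((C / C') ^ 2) ^ p = C ^ (2 * p) / (C' ^ p / K) ^ 2 := by
      rw [← pow_mul, div_pow, div_pow, ← pow_mul, mul_comm p 2]
      field_simp
    rw [e, le_div_iff₀ (by positivity), mul_comm]
    exact this
  have hzero : cfc g a = 0 := by
    apply faithful
    have hn := nonneg (cfc g a)
    rw [hsa.star_eq] at hn ⊢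
    have := Complex.le_def.1 hn
    exact Complex.ext (le_antisymm hφ0 this.1) this.2.symm
  have hspec : ∀ t ∈ spectrum ℝ a, |t| ≤ C' := by
    intro t ht
    have h1 := norm_apply_le_norm_cfc g a ht
    rw [hzero, norm_zero, norm_le_zero_iff] at h1
    have : |t| - C' ≤ g t := le_max_left _ _
    linarith
  have : ‖a‖ ≤ C' := by
    have := norm_cfc_le (f := id) (a := a) hC'0.le fun t ht => by
      rw [id, Real.norm_eq_abs]; exact hspec t ht
    rwa [cfc_id ℝ a] at this
  linarith

variable {H : Type*} [NormedAddCommGroup H] [InnerProductSpace ℂ H] [CompleteSpace H]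

namespace WStarProbabilitySpace

variable (P : WStarProbabilitySpace H)

theorem isClosed_alg : IsClosed (P.Alg : Set (H →L[ℂ] H)) := by
  have h : (P.Alg : Set (H →L[ℂ] H)) =
      Set.centralizer (Set.centralizer (P.algebra : Set (H →L[ℂ] H))) := by
    rw [VonNeumannAlgebra.centralizer_centralizer]; rfl
  rw [h]
  exact Set.isClosed_centralizer _

theorem completeSpace_alg : CompleteSpace P.Alg :=
  P.isClosed_alg.completeSpace_coe

theorem map_star (x : P.Alg) : P.φ (star x) = starRingEnd ℂ (P.φ x) :=
  map_star_of_nonneg P.φ P.nonneg x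

theorem norm_le_of_moments_le (a : P.Alg) (ha : IsSelfAdjoint a) (C : ℝ) (hC : 0 ≤ C)
    (h : ∀ p : ℕ, (P.φ (a ^ (2 * p))).re ≤ C ^ (2 * p)) : ‖a‖ ≤ C := by
  have := P.isClosed_alg
  exact FreeProb.norm_le_of_moments_le (A := P.Alg) P.φ P.nonneg P.faithful a ha C hC h

/-- The functional of a `W*`-probability space is norm continuous. -/
theorem continuous_φ : Continuous P.φ := by
  rw [continuous_iff_continuousAt]
  intro a
  refine P.normal (𝓝 a) a (‖a‖ + 1) ?_ fun ξ η => ?_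
  · exact (continuous_norm.tendsto a).eventually (ge_mem_nhds (lt_add_one _))
  · have h : Continuous fun x : P.Alg => ⟪ξ, (x : H →L[ℂ] H) η⟫_ℂ := by fun_prop
    exact h.tendsto a

/-- The algebra as a pre-Hilbert space for `⟪x, y⟫ = φ(x* y)`. -/
def L2 : Type _ := P.Alg

instance : AddCommGroup P.L2 := inferInstanceAs (AddCommGroup P.Alg)

instance : Module ℂ P.L2 := inferInstanceAs (Module ℂ P.Alg)

/-- The identity map into the pre-Hilbert space. -/
def toL2 : P.Alg ≃ₗ[ℂ] P.L2 := LinearEquiv.refl ℂ P.Alg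

/-- The inner product `φ(x* y)`. -/
@[reducible] def l2Core : InnerProductSpace.Core ℂ P.L2 where
  inner x y := P.φ (star (P.toL2.symm x) * P.toL2.symm y)
  conj_inner_symm x y := by rw [← P.map_star, star_mul, star_star]
  re_inner_nonneg x := (Complex.le_def.1 (P.nonneg _)).1
  add_left x y z := by simp [add_mul]
  smul_left x y r := by simp
  definite x h := by simpa using P.faithful _ h

instance : NormedAddCommGroup P.L2 := P.l2Core.toNormedAddCommGroup

instance : InnerProductSpace ℂ P.L2 := InnerProductSpace.ofCore P.l2Core.toCore

theorem inner_toL2 (x y : P.Alg) : ⟪P.toL2 x, P.toL2 y⟫_ℂ = P.φ (star x * y) := rfl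

theorem norm_toL2 (x : P.Alg) : ‖P.toL2 x‖ = P.norm₂ x := rfl

theorem φ_star_mul_self (x : P.Alg) : P.φ (star x * x) = ((P.norm₂ x ^ 2 : ℝ) : ℂ) := by
  rw [← inner_toL2, ← norm_toL2, inner_self_eq_norm_sq_to_K]; simp

theorem norm₂_nonneg (x : P.Alg) : 0 ≤ P.norm₂ x := Real.sqrt_nonneg _

theorem eq_zero_of_norm₂ (x : P.Alg) (h : P.norm₂ x = 0) : x = 0 := by
  apply P.faithful
  rw [φ_star_mul_self, h]; simp

theorem continuous_norm₂ : Continuous P.norm₂ := by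
  have := P.continuous_φ
  unfold norm₂
  fun_prop

end WStarProbabilitySpace

end

/-! ### Wick families: orthonormality, Haagerup's inequality and the fourth moment. -/

section

theorem norm_sum_mul_sq_le {α : Type*} (s : Finset α) (c d : α → ℂ) :
    ‖∑ u ∈ s, c u * d u‖ ^ 2 ≤ (∑ u ∈ s, ‖c u‖ ^ 2) * ∑ u ∈ s, ‖d u‖ ^ 2 := by
  calc ‖∑ u ∈ s, c u * d u‖ ^ 2 ≤ (∑ u ∈ s, ‖c u‖ * ‖d u‖) ^ 2 := by
        gcongr
        exact (norm_sum_le _ _).trans_eq (by simp_rw [norm_mul])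
    _ ≤ _ := Finset.sum_mul_sq_le_sq_mul_sq _ _ _

/-- The quadratic form of a Gram matrix is controlled by its Hilbert-Schmidt norm. -/
theorem norm_sum_sum_pow_four_le {α β : Type*} (s : Finset α) (t : Finset β) (c : α → β → ℂ)
    (g : α → ℂ) (h : β → ℂ) :
    ‖∑ i ∈ s, ∑ u ∈ t, c i u * (g i * h u)‖ ^ 4 ≤
      ((∑ i ∈ s, ‖g i‖ ^ 2) * ∑ u ∈ t, ‖h u‖ ^ 2) ^ 2 *
        ∑ i ∈ s, ∑ j ∈ s, ‖∑ u ∈ t, c i u * starRingEnd ℂ (c j u)‖ ^ 2 := by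
  set G : α → α → ℂ := fun i j => ∑ u ∈ t, c i u * starRingEnd ℂ (c j u) with hG
  -- Cauchy-Schwarz in `u` removes `h`. Expanding the remaining square produces the Gram matrix `G`,
  -- and a second Cauchy-Schwarz over pairs of indices removes `g`.
  have h1 : ‖∑ i ∈ s, ∑ u ∈ t, c i u * (g i * h u)‖ ^ 2 ≤
      (∑ u ∈ t, ‖h u‖ ^ 2) * ∑ u ∈ t, ‖∑ i ∈ s, g i * c i u‖ ^ 2 := by
    convert norm_sum_mul_sq_le t h fun u => ∑ i ∈ s, g i * c i u using 3
    rw [Finset.sum_comm]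
    refine Finset.sum_congr rfl fun u _ => ?_
    rw [Finset.mul_sum]
    exact Finset.sum_congr rfl fun i _ => by ring
  have h2 : ((∑ u ∈ t, ‖∑ i ∈ s, g i * c i u‖ ^ 2 : ℝ) : ℂ) =
      ∑ p ∈ s ×ˢ s, (g p.1 * starRingEnd ℂ (g p.2)) * G p.1 p.2 := by
    push_cast
    simp_rw [← Complex.mul_conj', map_sum, Finset.sum_mul_sum, hG, Finset.mul_sum,
      Finset.sum_product]
    rw [Finset.sum_comm]
    refine Finset.sum_congr rfl fun i _ => ?_
    rw [Finset.sum_comm]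
    refine Finset.sum_congr rfl fun j _ => Finset.sum_congr rfl fun u _ => ?_
    rw [map_mul]; ring
  have h3 : (∑ u ∈ t, ‖∑ i ∈ s, g i * c i u‖ ^ 2) ^ 2 ≤
      (∑ i ∈ s, ‖g i‖ ^ 2) ^ 2 * ∑ i ∈ s, ∑ j ∈ s, ‖G i j‖ ^ 2 := by
    have := norm_sum_mul_sq_le (s ×ˢ s) (fun p => g p.1 * starRingEnd ℂ (g p.2))
      fun p => G p.1 p.2
    rw [← h2, Complex.norm_real, Real.norm_eq_abs, sq_abs, Finset.sum_product,
      Finset.sum_product] at this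
    refine this.trans_eq ?_
    simp only [norm_mul, RCLike.norm_conj, mul_pow, ← Finset.sum_mul_sum]
    ring
  calc _ = (‖∑ i ∈ s, ∑ u ∈ t, c i u * (g i * h u)‖ ^ 2) ^ 2 := by ring
    _ ≤ ((∑ u ∈ t, ‖h u‖ ^ 2) * ∑ u ∈ t, ‖∑ i ∈ s, g i * c i u‖ ^ 2) ^ 2 := by gcongr
    _ = (∑ u ∈ t, ‖h u‖ ^ 2) ^ 2 * (∑ u ∈ t, ‖∑ i ∈ s, g i * c i u‖ ^ 2) ^ 2 := by ring
    _ ≤ (∑ u ∈ t, ‖h u‖ ^ 2) ^ 2 *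
        ((∑ i ∈ s, ‖g i‖ ^ 2) ^ 2 * ∑ i ∈ s, ∑ j ∈ s, ‖G i j‖ ^ 2) := by gcongr
    _ = _ := by ring

variable {H : Type*} [NormedAddCommGroup H] [InnerProductSpace ℂ H] [CompleteSpace H]

/-- A family of self-adjoint elements whose nontrivial Wick products are centred, i.e. a free
family of standard semicircular elements. -/
structure IsWickFamily (P : WStarProbabilitySpace H) {ι : Type*} [DecidableEq ι]
    (x : ι → P.Alg) : Prop where
  star_eq : ∀ i, star (x i) = x i
  map_wick : ∀ w ≠ [], P.φ (wick x w) = 0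

namespace IsWickFamily

variable {P : WStarProbabilitySpace H} {ι : Type*} [DecidableEq ι] {x : ι → P.Alg}

/-- Only the complete contraction leaves the empty word, the one Wick product that `φ` does not
annihilate. -/
theorem map_wick_reverse_mul (hx : IsWickFamily P x) : ∀ v w : List ι,
    P.φ (wick x v.reverse * wick x w) = if v = w then 1 else 0
  | [], [] => by simp [wick_nil, P.map_one]
  | [], j :: w => by simp [wick_nil, hx.map_wick]
  | i :: v, [] => by simp [wick_nil, hx.map_wick]
  | i :: v, j :: w => by
    rw [List.reverse_cons, wick_append_mul_cons, map_add, hx.map_wick _ (by simp), zero_add]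
    by_cases h : i = j
    · simp [h, hx.map_wick_reverse_mul v w]
    · simp [h]

theorem inner_wick (hx : IsWickFamily P x) (v w : List ι) :
    ⟪P.toL2 (wick x v), P.toL2 (wick x w)⟫_ℂ = if v = w then 1 else 0 := by
  rw [P.inner_toL2, star_wick x hx.star_eq, hx.map_wick_reverse_mul]

/-- Parseval's identity. The injective indexing `f` lets it apply to the product formula, whose
words are concatenations indexed by pairs or triples. -/
theorem norm₂_sum_sq (hx : IsWickFamily P x) {α : Type*} (F : Finset α)
    (f : α → List ι) (hf : Set.InjOn f F) (γ : α → ℂ) :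
    P.norm₂ (∑ p ∈ F, γ p • wick x (f p)) ^ 2 = ∑ p ∈ F, ‖γ p‖ ^ 2 := by
  have h : ((P.norm₂ (∑ p ∈ F, γ p • wick x (f p)) ^ 2 : ℝ) : ℂ) = 
      ((∑ p ∈ F, ‖γ p‖ ^ 2 : ℝ) : ℂ) := by
    rw [← P.φ_star_mul_self, ← P.inner_toL2]
    simp only [map_sum, map_smul, sum_inner, inner_sum, inner_smul_left, inner_smul_right,
      hx.inner_wick]
    push_cast
    refine Finset.sum_congr rfl fun p hp => ?_
    rw [Finset.sum_eq_single p]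
    · simp [Complex.mul_conj', mul_comm]
    · intro q hq hqp
      rw [if_neg fun h => hqp (hf hq hp h)]; simp
    · exact fun h => absurd hp h
  exact_mod_cast h

variable [Fintype ι]

theorem exists_wordsLT {Y : P.Alg} (hY : Y ∈ Submodule.span ℂ (Set.range (wick x))) :
    ∃ (N : ℕ) (d : List ι → ℂ), Y = ∑ w ∈ wordsLT ι N, d w • wick x w := by
  obtain ⟨c, rfl⟩ := (Finsupp.mem_span_range_iff_exists_finsupp).1 hY
  refine ⟨c.support.sup List.length + 1, c, Finset.sum_subset ?_ ?_⟩
  · intro w hw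
    rw [mem_wordsLT, Nat.lt_succ_iff]
    exact Finset.le_sup (f := List.length) hw
  · intro w _ hw
    simp [Finsupp.notMem_support_iff.1 hw]

theorem sum_words_mul_mem_span (n : ℕ) (c : List ι → ℂ) {Y : P.Alg}
    (hY : Y ∈ Submodule.span ℂ (Set.range (wick x))) :
    (∑ v ∈ words ι n, c v • wick x v) * Y ∈ Submodule.span ℂ (Set.range (wick x)) := by
  obtain ⟨N, d, rfl⟩ := exists_wordsLT hY
  rw [sum_wick_mul_sum_wick]
  exact Submodule.sum_mem _ fun k _ => Submodule.sum_mem _ fun a _ => Submodule.sum_mem _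
    fun b _ => Submodule.smul_mem _ _ (Submodule.subset_span ⟨_, rfl⟩)

theorem injOn_append {m : ℕ} (s : Finset (List ι)) :
    Set.InjOn (fun p : List ι × List ι => p.1 ++ p.2) ((words ι m ×ˢ s : Finset _) : Set _) := by
  rintro ⟨a, b⟩ hp ⟨a', b'⟩ hq h
  simp only [Finset.coe_product, Set.mem_prod, Finset.mem_coe, mem_words] at hp hq
  obtain ⟨h₁, h₂⟩ := List.append_inj h (hp.1.trans hq.1.symm)
  exact Prod.ext h₁ h₂

/-- Haagerup's inequality, in the form of a bound for left multiplication in `L²`. -/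
theorem norm₂_sum_words_mul_le (hx : IsWickFamily P x) (n : ℕ) (c : List ι → ℂ) {Y : P.Alg}
    (hY : Y ∈ Submodule.span ℂ (Set.range (wick x))) :
    P.norm₂ ((∑ v ∈ words ι n, c v • wick x v) * Y) ≤
      (n + 1) * √(∑ v ∈ words ι n, ‖c v‖ ^ 2) * P.norm₂ Y := by
  obtain ⟨N, d, rfl⟩ := exists_wordsLT hY
  have hd := hx.norm₂_sum_sq (wordsLT ι N) id (Set.injOn_id _) d
  simp only [id] at hd
  rw [sum_wick_mul_sum_wick, ← P.norm_toL2, map_sum]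
  -- The factor `n + 1` counts the possible contraction orders `k`; each term is bounded by
  -- Cauchy-Schwarz in the contracted word.
  refine (norm_sum_le_of_le _ (n := fun _ => √(∑ v ∈ words ι n, ‖c v‖ ^ 2) *
    P.norm₂ (∑ w ∈ wordsLT ι N, d w • wick x w)) fun k hk => ?_).trans_eq ?_
  · rw [← Real.sqrt_sq (P.norm₂_nonneg (∑ w ∈ wordsLT ι N, d w • wick x w)), hd,
      ← Real.sqrt_mul (Finset.sum_nonneg fun _ _ => by positivity), P.norm_toL2,
      ← Finset.sum_product']
    apply Real.le_sqrt_of_sq_le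
    rw [hx.norm₂_sum_sq _ (fun p : List ι × List ι => p.1 ++ p.2) (injOn_append _)
      (fun p => ∑ u ∈ words ι k, c (p.1 ++ u) * d (u.reverse ++ p.2))]
    obtain ⟨m, rfl⟩ : ∃ m, n = m + k := ⟨n - k, by rw [Finset.mem_range] at hk; omega⟩
    calc ∑ p ∈ words ι (m + k - k) ×ˢ wordsLT ι (N - k),
          ‖∑ u ∈ words ι k, c (p.1 ++ u) * d (u.reverse ++ p.2)‖ ^ 2
        ≤ ∑ p ∈ words ι (m + k - k) ×ˢ wordsLT ι (N - k), (∑ u ∈ words ι k, ‖c (p.1 ++ u)‖ ^ 2) *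
          ∑ u ∈ words ι k, ‖d (u.reverse ++ p.2)‖ ^ 2 :=
          Finset.sum_le_sum fun p _ => norm_sum_mul_sq_le _ _ _
      _ = (∑ v ∈ words ι (m + k), ‖c v‖ ^ 2) * ∑ w ∈ wordsLT ι N with k ≤ w.length, ‖d w‖ ^ 2 := by
          rw [sum_words_append, sum_wordsLT_append, Finset.sum_mul_sum, Finset.sum_product,
            Nat.add_sub_cancel]
          refine Finset.sum_congr rfl fun a _ => ?_
          dsimp only
          rw [← Finset.mul_sum, ← Finset.mul_sum, Finset.sum_comm,
            sum_words_reverse k fun u => ∑ b ∈ wordsLT ι (N - k), ‖d (u ++ b)‖ ^ 2]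
      _ ≤ _ := by
          gcongr
          exact Finset.filter_subset _ _
  · simp; ring

theorem star_sum_words (hx : IsWickFamily P x) (n : ℕ) (c : List ι → ℂ) :
    star (∑ v ∈ words ι n, c v • wick x v) =
      ∑ v ∈ words ι n, starRingEnd ℂ (c v.reverse) • wick x v := by
  rw [star_sum, ← sum_words_reverse]
  exact Finset.sum_congr rfl fun v _ => by
    rw [star_smul, star_wick x hx.star_eq, List.reverse_reverse]; rfl

/-- Haagerup's inequality for the operator norm. -/
theorem norm_sum_words_le (hx : IsWickFamily P x) (n : ℕ) (c : List ι → ℂ) :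
    ‖∑ v ∈ words ι n, c v • wick x v‖ ≤ (n + 1) * √(∑ v ∈ words ι n, ‖c v‖ ^ 2) := by
  set X := ∑ v ∈ words ι n, c v • wick x v with hX
  set C : ℝ := (n + 1) * √(∑ v ∈ words ι n, ‖c v‖ ^ 2) with hC
  have hC0 : 0 ≤ C := by positivity
  have hstar := hx.star_sum_words n c
  have hC' : C = (n + 1) * √(∑ v ∈ words ι n, ‖starRingEnd ℂ (c v.reverse)‖ ^ 2) := by
    simp only [RCLike.norm_conj]
    rw [sum_words_reverse n fun v => ‖c v‖ ^ 2]
  -- The `L²` bound applies only to the span of Wick products, so membership of the powers in the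
  -- span is carried along the induction.
  have hpow : ∀ p : ℕ, (star X * X) ^ p ∈ Submodule.span ℂ (Set.range (wick x)) ∧
      P.norm₂ ((star X * X) ^ p) ≤ (C ^ 2) ^ p := by
    intro p
    induction p with
    | zero =>
      refine ⟨Submodule.subset_span ⟨[], by simp [wick_nil]⟩, ?_⟩
      simp [WStarProbabilitySpace.norm₂, P.map_one]
    | succ p ih =>
      have h1 := sum_words_mul_mem_span (x := x) n c ih.1
      have h2 := hx.norm₂_sum_words_mul_le n c ih.1
      have h3 := sum_words_mul_mem_span (x := x) n (fun v => starRingEnd ℂ (c v.reverse)) h1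
      have h4 := hx.norm₂_sum_words_mul_le n (fun v => starRingEnd ℂ (c v.reverse)) h1
      rw [← hstar, ← hX] at h3 h4
      rw [← hX, ← hC] at h2
      rw [← hC'] at h4
      rw [pow_succ', mul_assoc]
      refine ⟨h3, h4.trans ?_⟩
      calc C * P.norm₂ (X * (star X * X) ^ p) ≤ C * (C * (C ^ 2) ^ p) := by
            gcongr
            exact h2.trans (by gcongr; exact ih.2)
        _ = _ := by ring
  have hsa : IsSelfAdjoint (star X * X) := IsSelfAdjoint.star_mul_self X
  have hle : ‖star X * X‖ ≤ C ^ 2 := by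
    -- The even moments of `X* X` are the squares of the `L²` norms just bounded, so the moment
    -- criterion turns an `L²` estimate into an operator norm estimate.
    refine P.norm_le_of_moments_le _ hsa _ (by positivity) fun p => ?_
    have h1 : (star X * X) ^ (2 * p) = star ((star X * X) ^ p) * (star X * X) ^ p := by
      rw [(hsa.pow p).star_eq, ← pow_add, two_mul]
    rw [h1, P.φ_star_mul_self, Complex.ofReal_re, mul_comm 2 p, pow_mul]
    have := P.norm₂_nonneg ((star X * X) ^ p)
    gcongr
    exact (hpow p).2
  rw [CStarRing.norm_star_mul_self, ← sq] at hle
  exact (sq_le_sq₀ (norm_nonneg _) hC0).1 hle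

theorem norm₂_sum_words (hx : IsWickFamily P x) (n : ℕ) (c : List ι → ℂ) :
    P.norm₂ (∑ v ∈ words ι n, c v • wick x v) ^ 2 = ∑ v ∈ words ι n, ‖c v‖ ^ 2 :=
  hx.norm₂_sum_sq (words ι n) id (Set.injOn_id _) c

theorem map_sum_words (hx : IsWickFamily P x) {n : ℕ} (hn : n ≠ 0) (c : List ι → ℂ) :
    P.φ (∑ v ∈ words ι n, c v • wick x v) = 0 := by
  rw [map_sum]
  refine Finset.sum_eq_zero fun v hv => ?_
  rw [mem_words] at hv
  rw [map_smul, hx.map_wick v (List.ne_nil_of_length_pos (by omega)), smul_zero]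

theorem sum_words_mul_star (hx : IsWickFamily P x) (n : ℕ) (c : List ι → ℂ) :
    (∑ v ∈ words ι n, c v • wick x v) * star (∑ v ∈ words ι n, c v • wick x v) =
      ∑ k ∈ Finset.range (n + 1), ∑ a ∈ words ι (n - k), ∑ b ∈ words ι (n - k),
        (∑ u ∈ words ι k, c (a ++ u) * starRingEnd ℂ (c (b ++ u))) • wick x (a ++ b.reverse) := by
  -- The adjoint's coefficients, extended by zero to other lengths because the product formula takes
  -- its right factor over all words shorter than a bound.
  set d : List ι → ℂ := fun w => if w.length = n then starRingEnd ℂ (c w.reverse) else 0 with hd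
  have h : star (∑ v ∈ words ι n, c v • wick x v) = ∑ w ∈ wordsLT ι (n + 1), d w • wick x w := by
    rw [hx.star_sum_words]
    refine Finset.sum_subset_zero_on_sdiff ?_ ?_ ?_
    · intro w; simp only [mem_words, mem_wordsLT]; omega
    · intro w hw
      simp only [Finset.mem_sdiff, mem_words] at hw
      simp [hd, hw.2]
    · intro w hw
      simp [hd, mem_words.1 hw]
  rw [h, sum_wick_mul_sum_wick]
  refine Finset.sum_congr rfl fun k hk => Finset.sum_congr rfl fun a _ => ?_
  rw [Finset.mem_range] at hk
  rw [← sum_words_reverse (n - k)]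
  refine (Finset.sum_subset_zero_on_sdiff ?_ ?_ ?_).symm
  · intro w; simp only [mem_words, mem_wordsLT]; omega
  · intro b hb
    simp only [Finset.mem_sdiff, mem_words, mem_wordsLT] at hb
    rw [Finset.sum_eq_zero, zero_smul]
    intro u hu
    rw [mem_words] at hu
    simp only [hd, List.length_append, List.length_reverse, hu]
    rw [if_neg (by omega), mul_zero]
  · intro b hb
    rw [List.reverse_reverse]
    congr 1
    refine Finset.sum_congr rfl fun u hu => ?_
    rw [mem_words] at hb hu
    simp only [hd, List.length_append, List.length_reverse, hu, hb, List.reverse_append,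
      List.reverse_reverse]
    rw [if_pos (by omega)]

/-- The fourth moment of a homogeneous Wick polynomial as a sum of contraction norms. -/
theorem norm₂_mul_star_sq (hx : IsWickFamily P x) (n : ℕ) (c : List ι → ℂ) :
    P.norm₂ ((∑ v ∈ words ι n, c v • wick x v) * star (∑ v ∈ words ι n, c v • wick x v)) ^ 2 =
      ∑ k ∈ Finset.range (n + 1), ∑ a ∈ words ι (n - k), ∑ b ∈ words ι (n - k),
        ‖∑ u ∈ words ι k, c (a ++ u) * starRingEnd ℂ (c (b ++ u))‖ ^ 2 := by
  rw [hx.sum_words_mul_star]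
  simp only [← Finset.sum_product', Finset.sum_sigma']
  refine hx.norm₂_sum_sq _ (fun q : (_ : ℕ) × (List ι × List ι) => q.2.1 ++ q.2.2.reverse) ?_
    fun q => ∑ u ∈ words ι q.1, c (q.2.1 ++ u) * starRingEnd ℂ (c (q.2.2 ++ u))
  rintro ⟨k, a, b⟩ h ⟨k', a', b'⟩ h' heq
  simp only [Finset.coe_sigma, Set.mem_sigma_iff, Finset.mem_coe, Finset.mem_product, mem_words,
    Finset.mem_range] at h h' heq
  -- The word has length `2(n - k)`, so it determines `k`, then `a` and `b`: different contraction
  -- orders are orthogonal.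
  have hlen := congrArg List.length heq
  simp only [List.length_append, List.length_reverse] at hlen
  obtain rfl : k = k' := by omega
  obtain ⟨rfl, h₂⟩ := List.append_inj heq (by omega)
  rw [List.reverse_injective h₂]

/-- The contractions of order `0` and `n` both give `‖c‖⁴`. Since `n ≥ 2`, order `n - 1` is distinct
from both and is kept; the other terms are nonnegative and dropped. -/
theorem le_norm₂_mul_star_sq (hx : IsWickFamily P x) (n : ℕ) (hn : 2 ≤ n) (c : List ι → ℂ) :
    2 * (∑ v ∈ words ι n, ‖c v‖ ^ 2) ^ 2 +
      ∑ i, ∑ j, ‖∑ u ∈ words ι (n - 1), c (i :: u) * starRingEnd ℂ (c (j :: u))‖ ^ 2 ≤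
    P.norm₂ ((∑ v ∈ words ι n, c v • wick x v) * star (∑ v ∈ words ι n, c v • wick x v)) ^ 2 := by
  rw [hx.norm₂_mul_star_sq]
  obtain ⟨m, rfl⟩ : ∃ m, n = m + 2 := ⟨n - 2, by omega⟩
  rw [Finset.sum_range_succ, Finset.sum_range_succ]
  have h0 : (∑ v ∈ words ι (m + 2), ‖c v‖ ^ 2) ^ 2 ≤ ∑ k ∈ Finset.range (m + 1),
      ∑ a ∈ words ι (m + 2 - k), ∑ b ∈ words ι (m + 2 - k),
        ‖∑ u ∈ words ι k, c (a ++ u) * starRingEnd ℂ (c (b ++ u))‖ ^ 2 := by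
    refine le_trans (le_of_eq ?_) (Finset.single_le_sum (fun k _ => Finset.sum_nonneg fun a _ =>
      Finset.sum_nonneg fun b _ => by positivity) (Finset.mem_range.2 (Nat.succ_pos m)))
    simp only [sum_words_zero, List.append_nil, norm_mul, RCLike.norm_conj, mul_pow, Nat.sub_zero]
    rw [← Finset.sum_mul_sum, sq]
  have h1 : (∑ v ∈ words ι (m + 2), ‖c v‖ ^ 2) ^ 2 = ∑ a ∈ words ι (m + 2 - (m + 2)),
      ∑ b ∈ words ι (m + 2 - (m + 2)),
        ‖∑ u ∈ words ι (m + 2), c (a ++ u) * starRingEnd ℂ (c (b ++ u))‖ ^ 2 := by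
    rw [Nat.sub_self, sum_words_zero, sum_words_zero]
    simp only [List.nil_append, Complex.mul_conj', ← Complex.ofReal_pow, ← Complex.ofReal_sum,
      Complex.norm_real, Real.norm_eq_abs, sq_abs]
  have h2 : m + 2 - (m + 1) = 1 := by omega
  have h3 : m + 2 - 1 = m + 1 := rfl
  rw [h2, h3, sum_words_one]
  simp only [sum_words_one, List.cons_append, List.nil_append]
  linarith

end IsWickFamily

end

/-! ### Semicircular laws, Chebyshev polynomials and freeness. -/

section

open Polynomial in
-- With `y = 2 cos θ`, the square root is `2 sin θ` and `sin θ` times the polynomial is `sin((k +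
-- 2)θ)`. The product formula for sines leaves `cos((k + 1)θ) - cos((k + 3)θ)`, and both cosines
-- integrate to zero over `[0, π]`.
theorem integral_sqrt_mul_chebyshev (k : ℕ) :
    ∫ y : ℝ, √(4 - y ^ 2) * (Chebyshev.S ℝ ((k + 1 : ℕ) : ℤ)).eval y = 0 := by
  set g : ℝ → ℝ := fun y => √(4 - y ^ 2) * (Chebyshev.S ℝ ((k + 1 : ℕ) : ℤ)).eval y with hg
  have hgc : Continuous g := by fun_prop
  have h1 : ∫ y : ℝ, g y = ∫ y in (-2 : ℝ)..2, g y := by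
    rw [intervalIntegral.integral_of_le (by norm_num),
      setIntegral_eq_integral_of_forall_compl_eq_zero]
    intro y hy
    have : √(4 - y ^ 2) = 0 := by
      apply Real.sqrt_eq_zero_of_nonpos
      simp only [Set.mem_Ioc, not_and_or, not_lt, not_le] at hy
      rcases hy with h | h <;> nlinarith
    simp only [hg, this, zero_mul]
  have h2 : ∫ θ in (0 : ℝ)..Real.pi, (g ∘ fun θ => 2 * Real.cos θ) θ * (2 * -Real.sin θ) =
      ∫ y in (2 * Real.cos 0)..(2 * Real.cos Real.pi), g y :=
    intervalIntegral.integral_comp_mul_deriv (fun θ _ => (Real.hasDerivAt_cos θ).const_mul 2)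
      (by fun_prop) hgc
  have h3 : ∀ m : ℝ, m ≠ 0 → ∫ θ in (0 : ℝ)..Real.pi, Real.cos (m * θ) =
      Real.sin (m * Real.pi) / m := by
    intro m hm
    rw [intervalIntegral.integral_comp_mul_left _ hm, integral_cos]
    simp [div_eq_inv_mul]
  have h4 : ∫ θ in (0 : ℝ)..Real.pi, (g ∘ fun θ => 2 * Real.cos θ) θ * (2 * -Real.sin θ) =
      ∫ θ in (0 : ℝ)..Real.pi, -2 *
        (Real.cos (((k + 1 : ℕ) : ℝ) * θ) - Real.cos (((k + 3 : ℕ) : ℝ) * θ)) := by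
    refine intervalIntegral.integral_congr fun θ hθ => ?_
    rw [Set.uIcc_of_le Real.pi_pos.le] at hθ
    have hs : √(4 - (2 * Real.cos θ) ^ 2) = 2 * Real.sin θ := by
      rw [← Real.sqrt_sq (x := 2 * Real.sin θ)
        (by have := Real.sin_nonneg_of_mem_Icc hθ; positivity)]
      congr 1
      have := Real.sin_sq_add_cos_sq θ
      nlinarith
    have hc := Chebyshev.S_two_mul_real_cos θ ((k + 1 : ℕ) : ℤ)
    have hcos : Real.cos (((k + 1 : ℕ) : ℝ) * θ) - Real.cos (((k + 3 : ℕ) : ℝ) * θ) =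
        2 * Real.sin θ * Real.sin ((((k + 1 : ℕ) : ℤ) + 1 : ℝ) * θ) := by
      have e1 : ((k + 1 : ℕ) : ℝ) * θ = (((k + 1 : ℕ) : ℤ) + 1 : ℝ) * θ - θ := by push_cast; ring
      have e2 : ((k + 3 : ℕ) : ℝ) * θ = (((k + 1 : ℕ) : ℤ) + 1 : ℝ) * θ + θ := by push_cast; ring
      rw [e1, e2, Real.cos_sub, Real.cos_add]; ring
    simp only [Function.comp, hg, hs, hcos]
    rw [← hc]; ring
  rw [h4, intervalIntegral.integral_const_mul, intervalIntegral.integral_sub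
    (Continuous.intervalIntegrable (by fun_prop) _ _)
    (Continuous.intervalIntegrable (by fun_prop) _ _), h3 _ (by positivity), h3 _ (by positivity),
    Real.sin_nat_mul_pi, Real.sin_nat_mul_pi, Real.cos_zero, Real.cos_pi] at h2
  rw [h1, intervalIntegral.integral_symm]
  simpa using h2.symm

theorem integral_semicircular (a v : ℝ) (hv : 0 < v) (q : ℝ → ℝ) :
    ∫ x, q ((√v)⁻¹ * (x - a)) ∂semicircular a v =
      1 / (2 * Real.pi) * ∫ y, √(4 - y ^ 2) * q y := by
  have hs : 0 < √v := Real.sqrt_pos.2 hv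
  have hd : ∀ x : ℝ, 0 ≤ 1 / (2 * Real.pi * v) * √(4 * v - (x - a) ^ 2) := fun x => by positivity
  rw [semicircular, integral_withDensity_eq_integral_toReal_smul (by fun_prop) (by simp)]
  simp only [ENNReal.toReal_ofReal (hd _), smul_eq_mul]
  have h : ∀ x : ℝ, 1 / (2 * Real.pi * v) * √(4 * v - (x - a) ^ 2) * q ((√v)⁻¹ * (x - a)) =
      (fun y => 1 / (2 * Real.pi * √v) * (√(4 - y ^ 2) * q y)) ((√v)⁻¹ * (x - a)) := by
    intro x
    have e : 4 * v - (x - a) ^ 2 = v * (4 - ((√v)⁻¹ * (x - a)) ^ 2) := by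
      rw [mul_pow, inv_pow, Real.sq_sqrt hv.le]; field_simp
    rw [e, Real.sqrt_mul hv.le]
    have hvv : v = √v * √v := (Real.mul_self_sqrt hv.le).symm
    have : 1 / (2 * Real.pi * v) * √v = 1 / (2 * Real.pi * √v) := by
      rw [div_mul_eq_mul_div, div_eq_div_iff (by positivity) (by positivity), one_mul, one_mul]
      nth_rewrite 3 [hvv]
      ring
    rw [← this]; ring
  simp_rw [h]
  rw [integral_sub_right_eq_self (fun x => (fun y => 1 / (2 * Real.pi * √v) *
    (√(4 - y ^ 2) * q y)) ((√v)⁻¹ * x)) a,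
    Measure.integral_comp_mul_left (fun y => 1 / (2 * Real.pi * √v) * (√(4 - y ^ 2) * q y))]
  rw [inv_inv, abs_of_pos hs, integral_const_mul, smul_eq_mul, ← mul_assoc]
  congr 1
  field_simp

variable {H : Type*} [NormedAddCommGroup H] [InnerProductSpace ℂ H] [CompleteSpace H]
  {P : WStarProbabilitySpace H}

open Polynomial in
theorem IsLaw.integrable_eval {X : P.Alg} {μ : Measure ℝ} (h : IsLaw P X μ) (q : ℝ[X]) :
    Integrable (fun x => q.eval x) μ := by
  induction q using Polynomial.induction_on' with
  | add p q hp hq =>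
    simp only [eval_add]
    exact hp.add hq
  | monomial n c => simpa using (h.integrable n).const_mul c

open Polynomial in
theorem IsLaw.map_aeval {X : P.Alg} {μ : Measure ℝ} (h : IsLaw P X μ) (q : ℝ[X]) :
    P.φ (aeval X (q.map (algebraMap ℝ ℂ))) = ((∫ x, q.eval x ∂μ : ℝ) : ℂ) := by
  induction q using Polynomial.induction_on' with
  | add p q hp hq =>
    simp only [Polynomial.map_add, map_add, hp, hq, eval_add]
    rw [integral_add (h.integrable_eval p) (h.integrable_eval q)]
    simp
  | monomial n c =>
    simp only [Polynomial.map_monomial, aeval_monomial, eval_monomial]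
    rw [integral_const_mul, Complex.ofReal_mul, h.moment, ← Algebra.smul_def, map_smul]
    rfl

open Polynomial in
/-- The Chebyshev polynomials of a normalized semicircular element are centred. -/
theorem IsLaw.map_aeval_chebyshev {X : P.Alg} {a v : ℝ} (hv : 0 < v)
    (h : IsLaw P X (semicircular a v)) (k : ℕ) :
    P.φ (aeval ((((√v)⁻¹ : ℝ) : ℂ) • (X - (a : ℂ) • 1)) (Chebyshev.S ℂ ((k + 1 : ℕ) : ℤ))) = 0 := by
  have h1 := h.map_aeval ((Chebyshev.S ℝ ((k + 1 : ℕ) : ℤ)).comp (C (√v)⁻¹ * (Polynomial.X - C a)))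
  simp only [eval_comp, eval_mul, eval_C, eval_sub, eval_X] at h1
  rw [integral_semicircular a v hv fun y => (Chebyshev.S ℝ ((k + 1 : ℕ) : ℤ)).eval y,
    integral_sqrt_mul_chebyshev, mul_zero, Complex.ofReal_zero] at h1
  rw [← h1]
  congr 1
  rw [Polynomial.map_comp, Chebyshev.map_S, aeval_comp]
  congr 2
  simp [Algebra.smul_def]

open Polynomial in
-- On a run of equal letters the Wick recursion is the recursion `S (k + 2) = X * S (k + 1) - S k`.
-- The condition on the head of `w` prevents a contraction at the end of the run.
theorem wick_replicate_append {ι A : Type*} [DecidableEq ι] [Ring A] [Algebra ℂ A] (x : ι → A)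
    (i : ι) (w : List ι) (hw : ∀ j ∈ w.head?, i ≠ j) : ∀ k : ℕ,
    wick x (List.replicate k i ++ w) = aeval (x i) (Chebyshev.S ℂ (k : ℤ)) * wick x w
  | 0 => by simp
  | 1 => by
    cases w with
    | nil => simp [wick_singleton, wick_nil]
    | cons j w => simp [wick_cons_cons, hw j (by simp)]
  | k + 2 => by
    have h1 := wick_replicate_append x i w hw (k + 1)
    have h2 := wick_replicate_append x i w hw k
    rw [List.replicate_succ, List.cons_append] at h1
    rw [List.replicate_succ, List.replicate_succ, List.cons_append, List.cons_append,
      wick_cons_cons, h1, h2]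
    push_cast
    rw [Chebyshev.S_add_two]
    simp [sub_mul, mul_assoc]

theorem exists_replicate_append {ι : Type*} [DecidableEq ι] (i : ι) (w : List ι) :
    ∃ (k : ℕ) (w' : List ι), i :: w = List.replicate (k + 1) i ++ w' ∧ (∀ j ∈ w'.head?, i ≠ j) ∧
      w'.length ≤ w.length := by
  induction w with
  | nil => exact ⟨0, [], by simp⟩
  | cons j w ih =>
    by_cases h : j = i
    · subst h
      obtain ⟨k, w', h1, h2, h3⟩ := ih
      exact ⟨k + 1, w', by rw [h1]; rfl, h2, h3.trans (by simp)⟩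
    · exact ⟨0, j :: w, by simp, by simpa using Ne.symm h, le_rfl⟩

theorem FreeSubalgebras.map_prod_eq_zero {ι : Type*} {B : ι → Subalgebra ℂ P.Alg}
    (hB : FreeSubalgebras P B) (L : List (ι × P.Alg)) (hL : L ≠ [])
    (hc : L.IsChain fun p q => p.1 ≠ q.1) (hm : ∀ p ∈ L, p.2 ∈ B p.1 ∧ P.φ p.2 = 0) :
    P.φ (L.map Prod.snd).prod = 0 := by
  obtain ⟨m, hlen⟩ : ∃ m, L.length = m + 1 := ⟨L.length - 1, by
    have := List.length_pos_of_ne_nil hL; omega⟩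
  have hget : ∀ j : Fin (m + 1), (j : ℕ) < L.length := fun j => by omega
  have h := hB m (fun j => (L[(j : ℕ)]'(hget j)).1) (fun j => (L[(j : ℕ)]'(hget j)).2)
    (fun j => List.isChain_iff_getElem.1 hc j (by omega))
    (fun j => (hm _ (List.getElem_mem _)).1) (fun j => (hm _ (List.getElem_mem _)).2)
  convert h using 3
  refine List.ext_getElem (by simp [hlen]) fun n h1 h2 => by simp [-List.ofFn_succ]

open Polynomial in
-- Cutting a word into maximal runs writes its Wick product as an alternating product of centred
-- Chebyshev polynomials, the shape that freeness annihilates. The clause on heads keeps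
-- neighbouring indices distinct in the induction.
theorem exists_factorization_wick {ι : Type*} [DecidableEq ι] {B : ι → Subalgebra ℂ P.Alg}
    (x : ι → P.Alg) (hx : ∀ i, x i ∈ B i)
    (hS : ∀ (i : ι) (k : ℕ), P.φ (aeval (x i) (Chebyshev.S ℂ ((k + 1 : ℕ) : ℤ))) = 0) :
    ∀ (n : ℕ) (w : List ι), w.length ≤ n → ∃ L : List (ι × P.Alg),
      L.head?.map Prod.fst = w.head? ∧ (L.IsChain fun p q => p.1 ≠ q.1) ∧
      (∀ p ∈ L, p.2 ∈ B p.1 ∧ P.φ p.2 = 0) ∧ wick x w = (L.map Prod.snd).prod := by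
  intro n
  induction n with
  | zero =>
    intro w hw
    rw [Nat.le_zero, List.length_eq_zero_iff] at hw
    subst hw
    exact ⟨[], by simp [wick_nil]⟩
  | succ n ih =>
    intro w hw
    cases w with
    | nil => exact ⟨[], by simp [wick_nil]⟩
    | cons i w =>
      obtain ⟨k, w', h1, h2, h3⟩ := exists_replicate_append i w
      obtain ⟨L, hL1, hL2, hL3, hL4⟩ := ih w' (by rw [List.length_cons] at hw; omega)
      refine ⟨(i, aeval (x i) (Chebyshev.S ℂ ((k + 1 : ℕ) : ℤ))) :: L, by simp, ?_, ?_, ?_⟩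
      · rw [List.isChain_cons]
        refine ⟨fun q hq => h2 q.1 ?_, hL2⟩
        rw [← hL1]
        exact Option.mem_map_of_mem _ hq
      · intro p hp
        rcases List.mem_cons.1 hp with rfl | hp
        · exact ⟨Algebra.adjoin_le (Set.singleton_subset_iff.2 (hx i))
            (aeval_mem_adjoin_singleton _ _), hS i k⟩
        · exact hL3 p hp
      · rw [h1, wick_replicate_append x i w' h2, hL4]
        simp

open Polynomial in
theorem isWickFamily_of_free {ι : Type*} [DecidableEq ι] {B : ι → Subalgebra ℂ P.Alg}
    (hB : FreeSubalgebras P B) (x : ι → P.Alg) (hx : ∀ i, x i ∈ B i) (hs : ∀ i, star (x i) = x i)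
    (hS : ∀ (i : ι) (k : ℕ), P.φ (aeval (x i) (Chebyshev.S ℂ ((k + 1 : ℕ) : ℤ))) = 0) :
    IsWickFamily P x where
  star_eq := hs
  map_wick w hw := by
    obtain ⟨L, h1, h2, h3, h4⟩ := exists_factorization_wick x hx hS w.length w le_rfl
    rw [h4]
    refine hB.map_prod_eq_zero L ?_ h2 h3
    rintro rfl
    cases w <;> simp_all

/-- The normalized increments of a free Brownian motion. -/
theorem IsFreeBrownianMotion.isWickFamily {S : ℝ≥0 → P.Alg} (hS : IsFreeBrownianMotion P S)
    (N : ℕ) (t : Fin (N + 1) → ℝ≥0) (ht : StrictMono t) :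
    IsWickFamily P fun i : Fin N =>
      (((√((t i.succ : ℝ) - t i.castSucc))⁻¹ : ℝ) : ℂ) • (S (t i.succ) - S (t i.castSucc)) := by
  refine isWickFamily_of_free (hS.free_increments N t ht) _ (fun i => ?_) (fun i => ?_)
    fun i k => ?_
  · exact Subalgebra.smul_mem _ (Algebra.self_mem_adjoin_singleton _ _) _
  · rw [star_smul, star_sub, (hS.isSelfAdjoint _).star_eq, (hS.isSelfAdjoint _).star_eq]
    simp
  · have hlt : t i.castSucc < t i.succ := ht i.castSucc_lt_succ
    have := (hS.law_increment _ _ hlt).map_aeval_chebyshev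
      (sub_pos.2 (NNReal.coe_lt_coe.2 hlt)) k
    simpa using this

/-- The mean, variance and fourth moment of a centred semicircular element. -/
theorem IsLaw.moments {X : P.Alg} {a v : ℝ} (hv : 0 < v) (h : IsLaw P X (semicircular a v)) :
    P.φ X = a ∧ (a = 0 → P.φ (X ^ 4) = 2 * P.φ (X ^ 2) ^ 2) := by
  have h1 := h.map_aeval_chebyshev hv 0
  have h2 := h.map_aeval_chebyshev hv 1
  have h4 := h.map_aeval_chebyshev hv 3
  have hs : (((√v)⁻¹ : ℝ) : ℂ) ≠ 0 := by
    have := Real.sqrt_pos.2 hv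
    exact_mod_cast (inv_pos.2 this).ne'
  constructor
  · simp only [zero_add, Nat.cast_one, Polynomial.Chebyshev.S_one, Polynomial.aeval_X, map_smul,
      map_sub, P.map_one, smul_eq_mul, mul_one] at h1
    exact sub_eq_zero.1 ((mul_eq_zero.1 h1).resolve_left hs)
  · rintro rfl
    set s : ℂ := (((√v)⁻¹ : ℝ) : ℂ) with hsdef
    have e2 : Polynomial.Chebyshev.S ℂ ((1 + 1 : ℕ) : ℤ) = Polynomial.X ^ 2 - 1 := by
      simpa using Polynomial.Chebyshev.S_two ℂ
    have e3 : Polynomial.Chebyshev.S ℂ 3 = Polynomial.X ^ 3 - 2 * Polynomial.X := by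
      have := Polynomial.Chebyshev.S_add_two ℂ 1
      norm_num at this
      rw [this, Polynomial.Chebyshev.S_two]; ring
    have e4 : Polynomial.Chebyshev.S ℂ ((3 + 1 : ℕ) : ℤ) =
        Polynomial.X ^ 4 - 3 * Polynomial.X ^ 2 + 1 := by
      have := Polynomial.Chebyshev.S_add_two ℂ 2
      norm_num at this
      norm_num
      rw [this, Polynomial.Chebyshev.S_two, e3]; ring
    rw [e2] at h2
    rw [e4] at h4
    have h3 : ∀ Y : P.Alg, (3 : P.Alg) * Y = (3 : ℂ) • Y := fun Y => by
      rw [Algebra.smul_def, map_ofNat]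
    simp only [Complex.ofReal_zero, zero_smul, sub_zero, map_sub, map_add, map_mul, map_pow,
      Polynomial.aeval_X, map_one, map_ofNat, P.map_one, smul_pow, map_smul, smul_eq_mul, h3]
      at h2 h4
    have hs4 : s ^ 4 ≠ 0 := pow_ne_zero _ hs
    apply mul_left_cancel₀ hs4
    -- Centredness of `S 2` and `S 4` reads `s² φ(X²) = 1` and `s⁴ φ(X⁴) = 3 s² φ(X²) - 1`.
    linear_combination h4 - (2 * s ^ 2 * P.φ (X ^ 2) - 1) * h2

end

/-! ### Step functions and their integrals expanded over a partition. -/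

section

variable {n : ℕ}

theorem OffDiagonalRectangle.measurableSet (R : OffDiagonalRectangle n) :
    MeasurableSet R.toSet :=
  MeasurableSet.univ_pi fun _ => measurableSet_Ioc

theorem OffDiagonalRectangle.orthantMeasure_ne_top (R : OffDiagonalRectangle n) :
    orthantMeasure n R.toSet ≠ ∞ := by
  refine ((Measure.restrict_apply_le _ _).trans_lt ?_).ne
  rw [OffDiagonalRectangle.toSet, Real.volume_pi_Ioc]
  exact ENNReal.prod_lt_top fun _ _ => ENNReal.ofReal_lt_top

theorem memLp_stepFunction (p : OffDiagonalRectangle n →₀ ℂ) :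
    MemLp (stepFunction p) 2 (orthantMeasure n) :=
  memLp_finsetSum _ fun R _ =>
    memLp_indicator_const 2 R.measurableSet _ (Or.inr R.orthantMeasure_ne_top)

theorem stepFunction_add (p q : OffDiagonalRectangle n →₀ ℂ) :
    stepFunction (p + q) = stepFunction p + stepFunction q := by
  classical
  ext x
  exact Finsupp.sum_add_index' (by simp) fun R a b => by
    by_cases h : x ∈ R.toSet <;> simp [h]

theorem stepFunction_smul (a : ℂ) (p : OffDiagonalRectangle n →₀ ℂ) :
    stepFunction (a • p) = a • stepFunction p := by
  ext x
  rw [stepFunction, Finsupp.sum_smul_index (by simp), Pi.smul_apply, stepFunction, Finsupp.smul_sum]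
  refine Finsupp.sum_congr fun R _ => ?_
  by_cases h : x ∈ R.toSet <;> simp [h]

/-- Step functions as elements of `L²`. -/
def stepLp (n : ℕ) : (OffDiagonalRectangle n →₀ ℂ) →ₗ[ℂ] L2Orthant n where
  toFun p := (memLp_stepFunction p).toLp (stepFunction p)
  map_add' p q := by
    rw [← MemLp.toLp_add]
    exact MemLp.toLp_congr _ _ (by rw [stepFunction_add])
  map_smul' a p := by
    rw [RingHom.id_apply, ← MemLp.toLp_const_smul]
    exact MemLp.toLp_congr _ _ (by rw [stepFunction_smul])

theorem coeFn_stepLp (p : OffDiagonalRectangle n →₀ ℂ) :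
    stepLp n p =ᵐ[orthantMeasure n] stepFunction p :=
  MemLp.coeFn_toLp (memLp_stepFunction p)

theorem eLpNorm_sub_stepFunction (f : L2Orthant n) (p : OffDiagonalRectangle n →₀ ℂ) :
    eLpNorm (fun x => f x - stepFunction p x) 2 (orthantMeasure n) =
      ENNReal.ofReal ‖f - stepLp n p‖ := by
  rw [Lp.norm_def, ENNReal.ofReal_toReal (Lp.eLpNorm_ne_top _)]
  refine eLpNorm_congr_ae ?_
  filter_upwards [Lp.coeFn_sub f (stepLp n p), coeFn_stepLp p] with x h1 h2
  rw [h1, Pi.sub_apply, h2]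

theorem inner_stepLp (q p : OffDiagonalRectangle n →₀ ℂ) :
    ⟪stepLp n q, stepLp n p⟫_ℂ =
      ∫ x, starRingEnd ℂ (stepFunction q x) * stepFunction p x ∂orthantMeasure n := by
  rw [L2.inner_def]
  refine integral_congr_ae ?_
  filter_upwards [coeFn_stepLp p, coeFn_stepLp q] with x h1 h2
  rw [h1, h2, RCLike.inner_apply, mul_comm]

section Partition

variable {N : ℕ} (t : Fin (N + 1) → ℝ≥0)

/-- The `i`-th cell of the partition lies in the interval `(a, b]`. -/
def cellCoeff (a b : ℝ≥0) (i : Fin N) : ℂ :=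
  if a ≤ t i.castSucc ∧ t i.succ ≤ b then 1 else 0

/-- Telescoping. The general `g` serves both the process `S` and, through `τ ↦ 1_{y ≤ τ}`, the
indicators of intervals, so functions and integrals acquire the same coefficients. -/
theorem sub_eq_sum_cells {G : Type*} [AddCommGroup G] [Module ℂ G] (ht : StrictMono t)
    (g : ℝ≥0 → G) {a b : ℝ≥0} (hab : a ≤ b) (ha : a ∈ Set.range t) (hb : b ∈ Set.range t) :
    g b - g a = ∑ i : Fin N, cellCoeff t a b i • (g (t i.succ) - g (t i.castSucc)) := by
  obtain ⟨α, rfl⟩ := ha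
  obtain ⟨β, rfl⟩ := hb
  rw [ht.le_iff_le] at hab
  set h : ℕ → G := fun k => if hk : k < N + 1 then g (t ⟨k, hk⟩) else 0 with hh
  have h1 : ∀ γ : Fin (N + 1), g (t γ) = h γ := fun γ => by
    simp only [hh, dif_pos γ.isLt]
  have h2 : ∀ i : Fin N, cellCoeff t (t α) (t β) i • (g (t i.succ) - g (t i.castSucc)) =
      if (i : ℕ) ∈ Finset.Ico (α : ℕ) β then h (i + 1) - h i else 0 := by
    intro i
    rw [h1, h1, cellCoeff]
    simp only [ht.le_iff_le, Finset.mem_Ico, Fin.le_def, Fin.val_castSucc, Fin.val_succ, Nat.succ_le_iff]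
    split_ifs <;> simp
  rw [Finset.sum_congr rfl fun i _ => h2 i,
    Fin.sum_univ_eq_sum_range (fun i => if i ∈ Finset.Ico (α : ℕ) β then h (i + 1) - h i else 0) N,
    ← Finset.sum_filter, h1, h1, ← Finset.sum_Ico_sub h (Fin.le_def.1 hab)]
  congr 1
  ext i
  simp only [Finset.mem_Ico, Finset.mem_filter, Finset.mem_range]
  omega

/-- The indicator of a cell. -/
def cellFun (i : Fin N) (x : ℝ) : ℂ :=
  (Set.Ioc (t i.castSucc : ℝ) (t i.succ)).indicator 1 x

/-- The length of a cell. -/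
def cellLength (i : Fin N) : ℝ := t i.succ - t i.castSucc

/-- The coefficients of an off-diagonal step function with respect to a partition. -/
def stepCoeff (p : OffDiagonalRectangle n →₀ ℂ) (w : Fin n → Fin N) : ℂ :=
  p.sum fun R c => c * ∏ j, cellCoeff t (R.s j) (R.t j) (w j)

/-- All sides of the rectangle have their end points in the partition. -/
def IsSubordinate (R : OffDiagonalRectangle n) : Prop :=
  ∀ j, R.s j ∈ Set.range t ∧ R.t j ∈ Set.range t

variable {t}

theorem cellLength_pos (ht : StrictMono t) (i : Fin N) : 0 < cellLength t i :=
  sub_pos.2 (NNReal.coe_lt_coe.2 (ht i.castSucc_lt_succ))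

theorem stepFunction_eq_sum_cells (ht : StrictMono t) (p : OffDiagonalRectangle n →₀ ℂ)
    (hp : ∀ R ∈ p.support, IsSubordinate t R) (x : Fin n → ℝ) :
    stepFunction p x = ∑ w : Fin n → Fin N, stepCoeff t p w * ∏ j, cellFun t (w j) (x j) := by
  have key : ∀ a b : ℝ≥0, a ≤ b → ∀ y : ℝ,
      (if y ≤ (b : ℝ) then (1 : ℂ) else 0) - (if y ≤ (a : ℝ) then (1 : ℂ) else 0) =
      (Set.Ioc (a : ℝ) b).indicator 1 y := by
    intro a b hab y
    have hab' : (a : ℝ) ≤ b := hab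
    rcases le_or_gt y a with h | h
    · simp [h, h.trans hab', not_lt.2 h]
    · rcases le_or_gt y b with h' | h' <;> simp [h, h', not_le_of_gt]
  have hR : ∀ R ∈ p.support, ∀ c : ℂ, R.toSet.indicator (fun _ => c) x =
      ∑ w : Fin n → Fin N, c * (∏ j, cellCoeff t (R.s j) (R.t j) (w j)) *
        ∏ j, cellFun t (w j) (x j) := by
    intro R hRp c
    have h1 : R.toSet.indicator (fun _ => c) x =
        c * ∏ j, (Set.Ioc (R.s j : ℝ) (R.t j)).indicator (1 : ℝ → ℂ) (x j) := by
      by_cases hx : x ∈ R.toSet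
      · rw [Set.indicator_of_mem hx, Finset.prod_eq_one, mul_one]
        intro j _
        rw [Set.indicator_of_mem (hx j (Set.mem_univ j)), Pi.one_apply]
      · rw [Set.indicator_of_notMem hx]
        obtain ⟨j, hj⟩ : ∃ j, x j ∉ Set.Ioc (R.s j : ℝ) (R.t j) := by
          by_contra! h
          exact hx fun j _ => h j
        rw [Finset.prod_eq_zero (Finset.mem_univ j) (Set.indicator_of_notMem hj _), mul_zero]
    have h2 : ∀ j, (Set.Ioc (R.s j : ℝ) (R.t j)).indicator (1 : ℝ → ℂ) (x j) =
        ∑ i : Fin N, cellCoeff t (R.s j) (R.t j) i * cellFun t i (x j) := by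
      intro j
      rw [← key _ _ (R.le j)]
      have := sub_eq_sum_cells t ht (fun τ : ℝ≥0 => if x j ≤ (τ : ℝ) then (1 : ℂ) else 0) (R.le j)
        (hp R hRp j).1 (hp R hRp j).2
      rw [this]
      refine Finset.sum_congr rfl fun i _ => ?_
      rw [key _ _ (ht i.castSucc_lt_succ).le, smul_eq_mul, cellFun]
    rw [h1]
    simp_rw [h2]
    rw [Finset.prod_univ_sum, Fintype.piFinset_univ, Finset.mul_sum]
    simp_rw [Finset.prod_mul_distrib, mul_assoc]
  simp only [stepFunction, stepCoeff, Finsupp.sum, Finset.sum_mul]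
  rw [Finset.sum_comm]
  exact Finset.sum_congr rfl fun R hRp => hR R hRp _

theorem cellFun_mul_cellFun (ht : StrictMono t) (i j : Fin N) (x : ℝ) :
    cellFun t i x * cellFun t j x = if i = j then cellFun t i x else 0 := by
  have hlt : ∀ i j : Fin N, i < j → cellFun t i x * cellFun t j x = 0 := by
    intro i j hij
    have : (t i.succ : ℝ) ≤ t j.castSucc :=
      NNReal.coe_le_coe.2 (ht.monotone (by rw [Fin.le_def]; simpa using hij))
    by_cases h : x ∈ Set.Ioc (t i.castSucc : ℝ) (t i.succ)
    · have h' : x ∉ Set.Ioc (t j.castSucc : ℝ) (t j.succ) := fun h' => by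
        linarith [h.2, h'.1]
      rw [cellFun, cellFun, Set.indicator_of_notMem h', mul_zero]
    · rw [cellFun, Set.indicator_of_notMem h, zero_mul]
  rcases lt_trichotomy i j with h | h | h
  · rw [hlt i j h, if_neg h.ne]
  · subst h
    rw [if_pos rfl, cellFun]
    by_cases h : x ∈ Set.Ioc (t i.castSucc : ℝ) (t i.succ) <;> simp [h]
  · rw [mul_comm, hlt j i h, if_neg h.ne']

theorem integral_prod_cellFun (ht : StrictMono t) (w : Fin n → Fin N) :
    Integrable (fun x : Fin n → ℝ => ∏ j, cellFun t (w j) (x j)) (orthantMeasure n) ∧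
    ∫ x, ∏ j, cellFun t (w j) (x j) ∂orthantMeasure n =
      ((∏ j, cellLength t (w j) : ℝ) : ℂ) := by
  constructor
  · refine Integrable.restrict (Integrable.fintype_prod (f := fun j y => cellFun t (w j) y)
      fun j => ?_)
    exact (integrable_indicator_iff measurableSet_Ioc).2
      (integrableOn_const (by simp) (by simp))
  · rw [orthantMeasure, setIntegral_eq_integral_of_forall_compl_eq_zero]
    · rw [integral_fintype_prod_volume_eq_prod (fun j y => cellFun t (w j) y), Complex.ofReal_prod]
      refine Finset.prod_congr rfl fun j _ => ?_
      unfold cellFun cellLength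
      have := (ht (w j).castSucc_lt_succ).le
      rw [integral_indicator measurableSet_Ioc]
      simp [this]
    · intro x hx
      obtain ⟨j, hj⟩ : ∃ j, x j < 0 := by
        by_contra! h
        exact hx h
      refine Finset.prod_eq_zero (Finset.mem_univ j) (Set.indicator_of_notMem (fun h => ?_) _)
      have := (t (w j).castSucc).coe_nonneg
      linarith [h.1]

theorem inner_stepLp_eq_sum (ht : StrictMono t) (q p : OffDiagonalRectangle n →₀ ℂ)
    (hq : ∀ R ∈ q.support, IsSubordinate t R) (hp : ∀ R ∈ p.support, IsSubordinate t R) :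
    ⟪stepLp n q, stepLp n p⟫_ℂ = ∑ w : Fin n → Fin N,
      starRingEnd ℂ (stepCoeff t q w) * stepCoeff t p w * ((∏ j, cellLength t (w j) : ℝ) : ℂ) := by
  rw [inner_stepLp]
  have hconj : ∀ i x, starRingEnd ℂ (cellFun t i x) = cellFun t i x := by
    intro i x
    unfold cellFun
    by_cases h : x ∈ Set.Ioc (t i.castSucc : ℝ) (t i.succ) <;> simp [h]
  have h : ∀ x, starRingEnd ℂ (stepFunction q x) * stepFunction p x = ∑ w : Fin n → Fin N,
      starRingEnd ℂ (stepCoeff t q w) * stepCoeff t p w * ∏ j, cellFun t (w j) (x j) := by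
    intro x
    rw [stepFunction_eq_sum_cells ht q hq, stepFunction_eq_sum_cells ht p hp, map_sum,
      Finset.sum_mul_sum]
    refine Finset.sum_congr rfl fun w _ => ?_
    rw [Finset.sum_eq_single w]
    · rw [map_mul, map_prod]
      simp_rw [hconj]
      rw [mul_mul_mul_comm, ← Finset.prod_mul_distrib]
      simp_rw [cellFun_mul_cellFun ht, if_true]
    · intro w' _ hne
      obtain ⟨j, hj⟩ := Function.ne_iff.1 hne
      rw [map_mul, map_prod]
      simp_rw [hconj]
      rw [mul_mul_mul_comm, ← Finset.prod_mul_distrib,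
        Finset.prod_eq_zero (Finset.mem_univ j), mul_zero]
      rw [cellFun_mul_cellFun ht, if_neg hj.symm]
    · simp
  simp_rw [h]
  rw [integral_finsetSum _ fun w _ => (integral_prod_cellFun ht w).1.const_mul _]
  simp_rw [integral_const_mul, (integral_prod_cellFun ht _).2]

/-- The off-diagonal condition enters here: a repeated cell would have its right end point in two
disjoint sides. -/
theorem stepCoeff_eq_zero (ht : StrictMono t) (p : OffDiagonalRectangle n →₀ ℂ)
    (w : Fin n → Fin N) (hw : ¬ Function.Injective w) : stepCoeff t p w = 0 := by
  rw [Function.Injective] at hw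
  push Not at hw
  obtain ⟨j, k, hjk, hne⟩ := hw
  refine Finset.sum_eq_zero fun R _ => mul_eq_zero_of_right _ ?_
  by_contra h0
  have hmem : ∀ j, t (w j).succ ∈ Set.Ioc (R.s j) (R.t j) := by
    intro j
    have := Finset.prod_ne_zero_iff.1 h0 j (Finset.mem_univ j)
    rw [cellCoeff, ite_ne_right_iff] at this
    exact ⟨this.1.1.trans_lt (ht (w j).castSucc_lt_succ), this.1.2⟩
  have h2 := hmem k
  rw [← hjk] at h2
  exact Set.disjoint_left.1 (R.disjoint hne) (hmem j) h2

variable {H : Type*} [NormedAddCommGroup H] [InnerProductSpace ℂ H] [CompleteSpace H]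
  {P : WStarProbabilitySpace H} {S : ℝ≥0 → P.Alg}

theorem stepIntegral_eq_sum_cells (ht : StrictMono t) (p : OffDiagonalRectangle n →₀ ℂ)
    (hp : ∀ R ∈ p.support, IsSubordinate t R) :
    stepIntegral P S p = ∑ w : Fin n → Fin N,
      stepCoeff t p w • (List.ofFn fun j => S (t (w j).succ) - S (t (w j).castSucc)).prod := by
  have hR : ∀ R ∈ p.support, ∀ c : ℂ, c • (List.ofFn fun i => S (R.t i) - S (R.s i)).prod =
      ∑ w : Fin n → Fin N, (c * (∏ j, cellCoeff t (R.s j) (R.t j) (w j))) •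
        (List.ofFn fun j => S (t (w j).succ) - S (t (w j).castSucc)).prod := by
    intro R hRp c
    have h := fun j => sub_eq_sum_cells t ht S (R.le j) (hp R hRp j).1 (hp R hRp j).2
    simp_rw [h]
    have h2 := MultilinearMap.map_sum (MultilinearMap.mkPiAlgebraFin ℂ n P.Alg)
      (fun j (i : Fin N) => cellCoeff t (R.s j) (R.t j) i • (S (t i.succ) - S (t i.castSucc)))
    simp only [MultilinearMap.map_smul_univ, MultilinearMap.mkPiAlgebraFin_apply] at h2
    rw [h2, Finset.smul_sum]
    simp_rw [smul_smul]
  simp only [stepIntegral, stepCoeff, Finsupp.sum, Finset.sum_smul]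
  rw [Finset.sum_comm]
  exact Finset.sum_congr rfl fun R hRp => hR R hRp _

/-- The normalized increments over the cells of a partition. -/
def normalizedIncrement (P : WStarProbabilitySpace H) (S : ℝ≥0 → P.Alg) (t : Fin (N + 1) → ℝ≥0)
    (i : Fin N) : P.Alg :=
  (((√(cellLength t i))⁻¹ : ℝ) : ℂ) • (S (t i.succ) - S (t i.castSucc))

/-- The coefficients of a step function with respect to the `L²`-normalized cells. -/
def wordCoeff (t : Fin (N + 1) → ℝ≥0) (p : OffDiagonalRectangle n →₀ ℂ) : List (Fin N) → ℂ :=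
  Function.extend List.ofFn
    (fun w : Fin n → Fin N => stepCoeff t p w * ((∏ j, √(cellLength t (w j)) : ℝ) : ℂ)) 0

theorem wordCoeff_ofFn (p : OffDiagonalRectangle n →₀ ℂ) (w : Fin n → Fin N) :
    wordCoeff t p (List.ofFn w) = stepCoeff t p w * ((∏ j, √(cellLength t (w j)) : ℝ) : ℂ) :=
  List.ofFn_injective.extend_apply _ _ _

theorem isChain_ofFn_of_injective {ι : Type*} (w : Fin n → ι) (hw : Function.Injective w) :
    (List.ofFn w).IsChain (· ≠ ·) :=
  (List.nodup_ofFn.2 hw).isChain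

/-- For a word with distinct letters the plain product is already the Wick product, and all other
words have coefficient zero. -/
theorem stepIntegral_eq_sum_wick (ht : StrictMono t) (p : OffDiagonalRectangle n →₀ ℂ)
    (hp : ∀ R ∈ p.support, IsSubordinate t R) :
    stepIntegral P S p = ∑ v ∈ words (Fin N) n,
      wordCoeff t p v • wick (normalizedIncrement P S t) v := by
  rw [stepIntegral_eq_sum_cells ht p hp, sum_words_ofFn]
  refine Finset.sum_congr rfl fun w _ => ?_
  rw [wordCoeff_ofFn]
  by_cases hw : Function.Injective w
  · rw [wick_eq_prod _ _ (isChain_ofFn_of_injective w hw), mul_smul]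
    congr 1
    have h : ∀ j, S (t (w j).succ) - S (t (w j).castSucc) =
        ((√(cellLength t (w j)) : ℝ) : ℂ) • normalizedIncrement P S t (w j) := by
      intro j
      have := Real.sqrt_pos.2 (cellLength_pos ht (w j))
      rw [normalizedIncrement, smul_smul, ← Complex.ofReal_mul, mul_inv_cancel₀ this.ne']
      simp
    simp_rw [h, ← MultilinearMap.mkPiAlgebraFin_apply (R := ℂ) (A := P.Alg)]
    rw [MultilinearMap.map_smul_univ, MultilinearMap.mkPiAlgebraFin_apply, List.map_ofFn]
    push_cast
    rfl
  · rw [stepCoeff_eq_zero ht p w hw, zero_mul, zero_smul, zero_smul]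

theorem inner_stepLp_eq_sum_words (ht : StrictMono t) (q p : OffDiagonalRectangle n →₀ ℂ)
    (hq : ∀ R ∈ q.support, IsSubordinate t R) (hp : ∀ R ∈ p.support, IsSubordinate t R) :
    ⟪stepLp n q, stepLp n p⟫_ℂ = ∑ v ∈ words (Fin N) n,
      starRingEnd ℂ (wordCoeff t q v) * wordCoeff t p v := by
  rw [inner_stepLp_eq_sum ht q p hq hp, sum_words_ofFn]
  refine Finset.sum_congr rfl fun w _ => ?_
  rw [wordCoeff_ofFn, wordCoeff_ofFn, map_mul, Complex.conj_ofReal, mul_mul_mul_comm,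
    ← Complex.ofReal_mul, ← Finset.prod_mul_distrib]
  simp_rw [Real.mul_self_sqrt (cellLength_pos ht _).le]

theorem norm_stepLp_sq (ht : StrictMono t) (p : OffDiagonalRectangle n →₀ ℂ)
    (hp : ∀ R ∈ p.support, IsSubordinate t R) :
    ‖stepLp n p‖ ^ 2 = ∑ v ∈ words (Fin N) n, ‖wordCoeff t p v‖ ^ 2 := by
  have h := inner_stepLp_eq_sum_words ht p p hp hp
  rw [inner_self_eq_norm_sq_to_K] at h
  simp_rw [Complex.conj_mul'] at h
  apply Complex.ofReal_injective
  push_cast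
  exact h

end Partition

theorem exists_partition (F : Finset (OffDiagonalRectangle n)) :
    ∃ (N : ℕ) (t : Fin (N + 1) → ℝ≥0), StrictMono t ∧ ∀ R ∈ F, IsSubordinate t R := by
  classical
  -- Inserting `0` makes `T` nonempty, so that its size has the form `N + 1`.
  set T : Finset ℝ≥0 := insert 0 (F.biUnion fun R =>
    Finset.univ.image R.s ∪ Finset.univ.image R.t) with hT
  have hc : T.card = (T.card - 1) + 1 := by
    have : 0 < T.card := Finset.card_pos.2 ⟨0, Finset.mem_insert_self _ _⟩
    omega
  refine ⟨T.card - 1, T.orderEmbOfFin hc, (T.orderEmbOfFin hc).strictMono, fun R hR j => ?_⟩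
  rw [Finset.range_orderEmbOfFin]
  constructor
  · refine Finset.mem_insert_of_mem (Finset.mem_biUnion.2 ⟨R, hR, Finset.mem_union_left _ ?_⟩)
    exact Finset.mem_image_of_mem _ (Finset.mem_univ j)
  · refine Finset.mem_insert_of_mem (Finset.mem_biUnion.2 ⟨R, hR, Finset.mem_union_right _ ?_⟩)
    exact Finset.mem_image_of_mem _ (Finset.mem_univ j)

theorem sum_words_succ {ι M : Type*} [Fintype ι] [DecidableEq ι] [AddCommMonoid M] (m : ℕ)
    (f : List ι → M) : ∑ w ∈ words ι (m + 1), f w = ∑ i, ∑ u ∈ words ι m, f (i :: u) := by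
  rw [add_comm m 1, sum_words_append, sum_words_one]
  rfl

/-- The indicator of a box is a tensor product: its first variable separates from the rest, as the
Gram matrix bound requires. -/
theorem wordCoeff_single_cons {m N : ℕ} (t : Fin (N + 1) → ℝ≥0) (R : OffDiagonalRectangle (m + 1)) :
    ∃ (g : Fin N → ℂ) (h : List (Fin N) → ℂ), ∀ i, ∀ u ∈ words (Fin N) m,
      wordCoeff t (Finsupp.single R 1) (i :: u) = g i * h u := by
  refine ⟨fun i => cellCoeff t (R.s 0) (R.t 0) i * ((√(cellLength t i) : ℝ) : ℂ),
    Function.extend List.ofFn (fun u : Fin m → Fin N =>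
      ∏ j, (cellCoeff t (R.s j.succ) (R.t j.succ) (u j) * ((√(cellLength t (u j)) : ℝ) : ℂ))) 0,
    fun i u hu => ?_⟩
  obtain ⟨u, rfl⟩ : ∃ u' : Fin m → Fin N, List.ofFn u' = u := by
    rw [mem_words] at hu
    subst hu
    exact ⟨u.get, List.ofFn_get u⟩
  have hcons : i :: List.ofFn u = List.ofFn (Fin.cons i u : Fin (m + 1) → Fin N) := by
    simp [List.ofFn_succ]
  rw [List.ofFn_injective.extend_apply, hcons, wordCoeff_ofFn, stepCoeff,
    Finsupp.sum_single_index (by simp), one_mul, Complex.ofReal_prod, ← Finset.prod_mul_distrib,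
    Fin.prod_univ_succ]
  simp

section Integral

variable {H : Type*} [NormedAddCommGroup H] [InnerProductSpace ℂ H] [CompleteSpace H]
  {P : WStarProbabilitySpace H} {S : ℝ≥0 → P.Alg}

theorem stepIntegral_sub (p q : OffDiagonalRectangle n →₀ ℂ) :
    stepIntegral P S (p - q) = stepIntegral P S p - stepIntegral P S q :=
  Finsupp.sum_sub_index fun _ _ _ => sub_smul _ _ _

namespace IsFreeBrownianMotion

theorem isWickFamily_normalizedIncrement (hS : IsFreeBrownianMotion P S) {N : ℕ}
    {t : Fin (N + 1) → ℝ≥0} (ht : StrictMono t) :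
    IsWickFamily P (normalizedIncrement P S t) :=
  hS.isWickFamily N t ht

/-- Haagerup's constant depends only on `n`, hence survives the choice of a partition. -/
theorem norm_stepIntegral_le (hS : IsFreeBrownianMotion P S) (p : OffDiagonalRectangle n →₀ ℂ) :
    ‖stepIntegral P S p‖ ≤ (n + 1) * ‖stepLp n p‖ := by
  obtain ⟨N, t, ht, hp⟩ := exists_partition p.support
  rw [stepIntegral_eq_sum_wick ht p hp, ← Real.sqrt_sq (norm_nonneg (stepLp n p)),
    norm_stepLp_sq ht p hp]
  exact (hS.isWickFamily_normalizedIncrement ht).norm_sum_words_le n _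

theorem norm₂_stepIntegral (hS : IsFreeBrownianMotion P S) (p : OffDiagonalRectangle n →₀ ℂ) :
    P.norm₂ (stepIntegral P S p) = ‖stepLp n p‖ := by
  obtain ⟨N, t, ht, hp⟩ := exists_partition p.support
  rw [← sq_eq_sq₀ (P.norm₂_nonneg _) (norm_nonneg _), stepIntegral_eq_sum_wick ht p hp,
    norm_stepLp_sq ht p hp]
  exact (hS.isWickFamily_normalizedIncrement ht).norm₂_sum_words n _

theorem map_stepIntegral (hS : IsFreeBrownianMotion P S) (hn : n ≠ 0)
    (p : OffDiagonalRectangle n →₀ ℂ) : P.φ (stepIntegral P S p) = 0 := by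
  obtain ⟨N, t, ht, hp⟩ := exists_partition p.support
  rw [stepIntegral_eq_sum_wick ht p hp]
  exact (hS.isWickFamily_normalizedIncrement ht).map_sum_words hn _

/-- The excess of the fourth moment of the integral of a step function is bounded below by its
overlaps with rectangles. -/
theorem norm_inner_pow_four_le (hS : IsFreeBrownianMotion P S) (hn : 2 ≤ n)
    (p : OffDiagonalRectangle n →₀ ℂ) (R : OffDiagonalRectangle n) :
    ‖⟪stepLp n (Finsupp.single R 1), stepLp n p⟫_ℂ‖ ^ 4 ≤
      (‖stepLp n (Finsupp.single R 1)‖ ^ 2) ^ 2 *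
        (P.norm₂ (stepIntegral P S p * star (stepIntegral P S p)) ^ 2 -
          2 * (‖stepLp n p‖ ^ 2) ^ 2) := by
  classical
  -- One partition has to resolve both `p` and the test rectangle `R`.
  obtain ⟨N, t, ht, hF⟩ := exists_partition (insert R p.support)
  have hp : ∀ R' ∈ p.support, IsSubordinate t R' := fun R' h => hF R' (Finset.mem_insert_of_mem h)
  have hR : ∀ R' ∈ (Finsupp.single R (1 : ℂ)).support, IsSubordinate t R' := by
    intro R' h
    have : R' = R := by simpa using Finsupp.support_single_subset h
    exact hF R' (this ▸ Finset.mem_insert_self _ _)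
  obtain ⟨m, rfl⟩ : ∃ m, n = m + 1 := ⟨n - 1, by omega⟩
  obtain ⟨g, h, hgh⟩ := wordCoeff_single_cons t R
  have hmain := (hS.isWickFamily_normalizedIncrement ht).le_norm₂_mul_star_sq (m + 1) hn
    (wordCoeff t p)
  rw [← stepIntegral_eq_sum_wick ht p hp, ← norm_stepLp_sq ht p hp] at hmain
  have hcs := norm_sum_sum_pow_four_le Finset.univ (words (Fin N) m)
    (fun i u => wordCoeff t p (i :: u)) (fun i => starRingEnd ℂ (g i))
    (fun u => starRingEnd ℂ (h u))
  have h1 : ⟪stepLp (m + 1) (Finsupp.single R 1), stepLp (m + 1) p⟫_ℂ =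
      ∑ i, ∑ u ∈ words (Fin N) m, wordCoeff t p (i :: u) *
        (starRingEnd ℂ (g i) * starRingEnd ℂ (h u)) := by
    rw [inner_stepLp_eq_sum_words ht _ p hR hp, sum_words_succ]
    refine Finset.sum_congr rfl fun i _ => Finset.sum_congr rfl fun u hu => ?_
    rw [hgh i u hu, map_mul]; ring
  have h2 : ‖stepLp (m + 1) (Finsupp.single R 1)‖ ^ 2 =
      (∑ i, ‖starRingEnd ℂ (g i)‖ ^ 2) * ∑ u ∈ words (Fin N) m, ‖starRingEnd ℂ (h u)‖ ^ 2 := by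
    rw [norm_stepLp_sq ht _ hR, sum_words_succ, Finset.sum_mul_sum]
    refine Finset.sum_congr rfl fun i _ => Finset.sum_congr rfl fun u hu => ?_
    rw [hgh i u hu, norm_mul, mul_pow, RCLike.norm_conj, RCLike.norm_conj]
  rw [h1, h2]
  refine hcs.trans ?_
  gcongr
  rw [Nat.add_sub_cancel] at hmain
  linarith

end IsFreeBrownianMotion

end Integral

end

/-! ### Totality of the off-diagonal rectangles in `L²`. -/

section

variable {n : ℕ}

theorem inner_stepLp_single (R : OffDiagonalRectangle n) (f : L2Orthant n) :
    ⟪stepLp n (Finsupp.single R 1), f⟫_ℂ = ∫ x in R.toSet, f x ∂orthantMeasure n := by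
  rw [← L2.inner_indicatorConstLp_one (𝕜 := ℂ) R.measurableSet R.orthantMeasure_ne_top f]
  congr 1
  apply Lp.ext
  filter_upwards [coeFn_stepLp (Finsupp.single R (1 : ℂ)), indicatorConstLp_coeFn (p := 2)
    (hs := R.measurableSet) (hμs := R.orthantMeasure_ne_top) (c := (1 : ℂ))] with x h1 h2
  rw [h1, h2, stepFunction, Finsupp.sum_single_index (by simp)]

/-- The intersection of an off-diagonal rectangle with a box. -/
theorem OffDiagonalRectangle.exists_toSet_eq_inter (R : OffDiagonalRectangle n)
    (a b : Fin n → ℝ) : ∃ R' : OffDiagonalRectangle n,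
      R'.toSet = (Set.univ.pi fun j => Set.Ioc (a j) (b j)) ∩ R.toSet := by
  set s : Fin n → ℝ≥0 := fun j => max (a j).toNNReal (R.s j)
  set t : Fin n → ℝ≥0 := fun j => max (s j) (min (b j).toNNReal (R.t j))
  have hst : ∀ j, Set.Ioc (s j : ℝ) (t j) =
      Set.Ioc (a j) (b j) ∩ Set.Ioc (R.s j : ℝ) (R.t j) := by
    intro j
    have h0 := (R.s j).coe_nonneg
    ext y
    simp only [s, t, Set.mem_Ioc, Set.mem_inter_iff, NNReal.coe_max, NNReal.coe_min,
      Real.coe_toNNReal', max_lt_iff, le_max_iff, le_min_iff]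
    grind
  have hsub : ∀ j, Set.Ioc (s j) (t j) ⊆ Set.Ioc (R.s j) (R.t j) := by
    intro j y hy
    have : (y : ℝ) ∈ Set.Ioc (s j : ℝ) (t j) := hy
    rw [hst] at this
    exact this.2
  refine ⟨⟨s, t, fun j => le_max_left _ _, fun i j hij =>
    (R.disjoint hij).mono (hsub i) (hsub j)⟩, ?_⟩
  rw [OffDiagonalRectangle.toSet, OffDiagonalRectangle.toSet, ← Set.pi_inter_distrib]
  simp_rw [hst]

theorem generateFrom_boxes (n : ℕ) :
    (MeasurableSpace.pi : MeasurableSpace (Fin n → ℝ)) = MeasurableSpace.generateFrom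
      (Set.univ.pi '' Set.univ.pi fun _ : Fin n =>
        {S | ∃ l u : ℝ, l < u ∧ Set.Ioc l u = S}) := by
  refine (generateFrom_eq_pi (fun _ => ?_) fun _ => ?_).symm
  · rw [← borel_eq_generateFrom_Ioc]; exact BorelSpace.measurable_eq.symm
  · refine ⟨fun k => Set.Ioc (-((k : ℝ) + 1)) (k + 1), fun k => ⟨_, _, ?_, rfl⟩, ?_⟩
    · have : (0 : ℝ) ≤ k := k.cast_nonneg
      linarith
    · refine Set.eq_univ_of_forall fun x => Set.mem_iUnion.2 ?_
      obtain ⟨k, hk⟩ := exists_nat_gt |x|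
      rw [abs_lt] at hk
      exact ⟨k, by constructor <;> linarith⟩

theorem isPiSystem_boxes (n : ℕ) :
    IsPiSystem (Set.univ.pi '' Set.univ.pi fun _ : Fin n =>
        {S | ∃ l u : ℝ, l < u ∧ Set.Ioc l u = S}) :=
  IsPiSystem.pi fun _ => isPiSystem_Ioc id id

/-- A π-λ argument inside `R`: boxes generate the Borel sets, and a box cut down to `R` is again an
off-diagonal rectangle. -/
theorem ae_restrict_eq_zero (f : L2Orthant n)
    (hf : ∀ R : OffDiagonalRectangle n, ∫ x in R.toSet, f x ∂orthantMeasure n = 0)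
    (R : OffDiagonalRectangle n) : ∀ᵐ x ∂(orthantMeasure n).restrict R.toSet, f x = 0 := by
  set ν := (orthantMeasure n).restrict R.toSet with hν
  have : IsFiniteMeasure ν :=
    ⟨by rw [hν, Measure.restrict_apply_univ]; exact R.orthantMeasure_ne_top.lt_top⟩
  have hint : Integrable f ν := ((Lp.memLp f).restrict R.toSet).integrable one_le_two
  refine hint.ae_eq_zero_of_forall_setIntegral_eq_zero fun A hA _ => ?_
  induction A, hA using MeasurableSpace.induction_on_inter (generateFrom_boxes n)
    (isPiSystem_boxes n) with
  | empty => simp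
  | basic A hA =>
    obtain ⟨B, hB, rfl⟩ := hA
    choose a b _ hab using fun j => hB j (Set.mem_univ j)
    obtain ⟨R', hR'⟩ := R.exists_toSet_eq_inter a b
    obtain rfl : B = fun j => Set.Ioc (a j) (b j) := funext fun j => (hab j).symm
    rw [hν, Measure.restrict_restrict (MeasurableSet.univ_pi fun _ => measurableSet_Ioc), ← hR']
    exact hf R'
  | compl A hA ih =>
    rw [setIntegral_compl hA hint, ih (measure_lt_top _ _), sub_zero]
    exact hf R
  | iUnion A hd hA ih =>
    rw [integral_iUnion hA hd hint.integrableOn]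
    simp [fun i => ih i (measure_lt_top _ _)]

/-- The exceptional points lie in finitely many kernels of nonzero linear functionals, which are
null sets. -/
theorem ae_pos_and_injective (n : ℕ) :
    ∀ᵐ x ∂orthantMeasure n, (∀ j, 0 < x j) ∧ ∀ j k, j ≠ k → x j ≠ x k := by
  have hvol : ∀ L : (Fin n → ℝ) →ₗ[ℝ] ℝ, L ≠ 0 → ∀ᵐ x ∂orthantMeasure n, L x ≠ 0 := by
    intro L hL
    refine ae_restrict_of_ae ?_
    have h := Measure.addHaar_submodule (volume : Measure (Fin n → ℝ)) (LinearMap.ker L)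
      (by rwa [Ne, LinearMap.ker_eq_top])
    rw [ae_iff]
    simpa using! h
  have h1 : ∀ᵐ x ∂orthantMeasure n, ∀ j, x j ≠ 0 := by
    rw [ae_all_iff]
    intro j
    refine hvol (LinearMap.proj j) fun h => ?_
    have := congrArg (fun L => L (Pi.single j 1)) h
    simp at this
  have h2 : ∀ᵐ x ∂orthantMeasure n, ∀ j k, j ≠ k → x j ≠ x k := by
    simp only [ae_all_iff]
    intro j k hjk
    let pr : Fin n → (Fin n → ℝ) →ₗ[ℝ] ℝ := fun i => LinearMap.proj i
    have : pr j - pr k ≠ 0 := fun h => by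
      have h' : (Pi.single j 1 : Fin n → ℝ) j - (Pi.single j 1 : Fin n → ℝ) k = 0 :=
        LinearMap.congr_fun h (Pi.single j (1 : ℝ) : Fin n → ℝ)
      rw [Pi.single_eq_same, Pi.single_eq_of_ne hjk.symm, sub_zero] at h'
      exact one_ne_zero h'
    filter_upwards [hvol _ this] with x hx
    exact sub_ne_zero.1 hx
  filter_upwards [h1, h2, ae_restrict_mem (measurableSet_Ici : MeasurableSet (Set.Ici _))]
    with x hx1 hx2 hx3
  exact ⟨fun j => lt_of_le_of_ne (hx3 j) (hx1 j).symm, hx2⟩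

theorem OffDiagonalRectangle.exists_mem_interior {x : Fin n → ℝ} (hpos : ∀ j, 0 < x j)
    (hinj : ∀ j k, j ≠ k → x j ≠ x k) :
    ∃ R : OffDiagonalRectangle n, x ∈ Set.univ.pi fun j => Set.Ioo (R.s j : ℝ) (R.t j) := by
  -- `ε < x j` keeps the cube of half-width `ε` in the orthant; `2 * ε < |x j - x k|` makes its
  -- sides disjoint.
  obtain ⟨ε, ⟨hε1, hε2⟩, hε0 : 0 < ε⟩ : ∃ ε : ℝ, ((∀ j, ε < x j) ∧
      ∀ j k, j ≠ k → 2 * ε < |x j - x k|) ∧ ε ∈ Set.Ioi (0 : ℝ) := by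
    have h1 : ∀ᶠ ε in 𝓝[>] (0 : ℝ), ∀ j, ε < x j :=
      eventually_all.2 fun j => nhdsWithin_le_nhds (gt_mem_nhds (hpos j))
    have h2 : ∀ᶠ ε in 𝓝[>] (0 : ℝ), ∀ j k, j ≠ k → 2 * ε < |x j - x k| := by
      refine eventually_all.2 fun j => eventually_all.2 fun k => ?_
      by_cases hjk : j = k
      · simp [hjk]
      · have h3 : 0 < |x j - x k| / 2 := by
          have := abs_pos.2 (sub_ne_zero.2 (hinj j k hjk)); positivity
        filter_upwards [nhdsWithin_le_nhds (gt_mem_nhds h3)] with ε hε _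
        linarith
    exact ((h1.and h2).and self_mem_nhdsWithin).exists
  refine ⟨⟨fun j => (x j - ε).toNNReal, fun j => (x j + ε).toNNReal,
    fun j => Real.toNNReal_mono (by linarith), fun j k hjk => ?_⟩, fun j _ => ?_⟩
  · refine Set.disjoint_left.2 ?_
    intro y hy hy'
    have e : ∀ j, ((x j - ε).toNNReal : ℝ) = x j - ε := fun j =>
      Real.coe_toNNReal _ (by linarith [hε1 j])
    have e' : ∀ j, ((x j + ε).toNNReal : ℝ) = x j + ε := fun j =>
      Real.coe_toNNReal _ (by linarith [hε1 j])
    have h1 : (y : ℝ) ∈ Set.Ioc ((x j - ε).toNNReal : ℝ) ((x j + ε).toNNReal) := hy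
    have h2 : (y : ℝ) ∈ Set.Ioc ((x k - ε).toNNReal : ℝ) ((x k + ε).toNNReal) := hy'
    rw [e, e', Set.mem_Ioc] at h1 h2
    have h3 := hε2 j k hjk
    rcases abs_cases (x j - x k) with h | h <;> linarith [h1.1, h1.2, h2.1, h2.2, h.1]
  · simp only [Set.mem_Ioo]
    rw [Real.coe_toNNReal _ (by linarith [hε1 j]), Real.coe_toNNReal _ (by linarith [hε1 j])]
    constructor <;> linarith

/-- Almost every point lies in the interior of an off-diagonal rectangle. By the Lindelöf property
countably many of these interiors suffice, so the null sets can be united. -/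
theorem eq_zero_of_forall_inner_stepLp (f : L2Orthant n)
    (hf : ∀ R : OffDiagonalRectangle n, ⟪stepLp n (Finsupp.single R 1), f⟫_ℂ = 0) : f = 0 := by
  simp_rw [inner_stepLp_single] at hf
  set U : OffDiagonalRectangle n → Set (Fin n → ℝ) := fun R =>
    Set.univ.pi fun j => Set.Ioo (R.s j : ℝ) (R.t j) with hU
  obtain ⟨T, hT, hTU⟩ := TopologicalSpace.isOpen_iUnion_countable U fun R =>
    isOpen_set_pi Set.finite_univ fun _ _ => isOpen_Ioo
  have h1 : ∀ᵐ x ∂orthantMeasure n, ∀ R ∈ T, x ∈ R.toSet → f x = 0 := by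
    rw [ae_ball_iff hT]
    exact fun R _ => (ae_restrict_iff' R.measurableSet).1 (ae_restrict_eq_zero f hf R)
  rw [Lp.eq_zero_iff_ae_eq_zero]
  filter_upwards [h1, ae_pos_and_injective n] with x hx1 hx2
  obtain ⟨R, hR⟩ := OffDiagonalRectangle.exists_mem_interior hx2.1 hx2.2
  have hx : x ∈ ⋃ R ∈ T, U R := hTU ▸ Set.mem_iUnion.2 ⟨R, hR⟩
  simp only [Set.mem_iUnion] at hx
  obtain ⟨R', hR'T, hxR'⟩ := hx
  exact hx1 R' hR'T fun j hj => Set.Ioo_subset_Ioc_self (hxR' j hj)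

theorem denseRange_stepLp (n : ℕ) : DenseRange (stepLp n) := by
  have h : (LinearMap.range (stepLp n)).topologicalClosure = ⊤ := by
    rw [Submodule.topologicalClosure_eq_top_iff, Submodule.eq_bot_iff]
    intro f hf
    exact eq_zero_of_forall_inner_stepLp f fun R =>
      (Submodule.mem_orthogonal _ f).1 hf _ (LinearMap.mem_range_self _ _)
  exact Submodule.dense_iff_topologicalClosure_eq_top.2 h

end

/-! ### Adjoints, construction of the Wigner integral and passage to the limit. -/

section

variable {n : ℕ}

theorem measurePreserving_rev (n : ℕ) :
    MeasurePreserving (fun (x : Fin n → ℝ) j => x j.rev) (orthantMeasure n) (orthantMeasure n) := by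
  have h : MeasurePreserving (fun (x : Fin n → ℝ) (j : Fin n) => x j.rev) volume volume := by
    convert! volume_measurePreserving_piCongrLeft (fun _ : Fin n => ℝ) Fin.revPerm using 1
    ext x j
    have := MeasurableEquiv.piCongrLeft_apply_apply Fin.revPerm x (i := j.rev)
      (β := fun _ : Fin n => ℝ)
    simpa using this.symm
  have h' := h.restrict_preimage (s := Set.Ici 0) measurableSet_Ici
  have e : (fun (x : Fin n → ℝ) (j : Fin n) => x j.rev) ⁻¹' Set.Ici 0 = Set.Ici 0 := by
    ext x
    simp only [Set.mem_preimage, Set.mem_Ici, Pi.le_def, Pi.zero_apply]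
    exact ⟨fun h j => by simpa using h j.rev, fun h j => h _⟩
  rwa [e] at h'

/-- The rectangle with its sides in reversed order. -/
def OffDiagonalRectangle.reverse (R : OffDiagonalRectangle n) : OffDiagonalRectangle n where
  s j := R.s j.rev
  t j := R.t j.rev
  le j := R.le j.rev
  disjoint _ _ h := R.disjoint (Fin.rev_injective.ne h)

/-- The adjoint of a step function. -/
def stepAdjoint (p : OffDiagonalRectangle n →₀ ℂ) : OffDiagonalRectangle n →₀ ℂ :=
  p.sum fun R c => Finsupp.single R.reverse (starRingEnd ℂ c)

theorem sum_stepAdjoint {M : Type*} [AddCommMonoid M] (p : OffDiagonalRectangle n →₀ ℂ)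
    (h : OffDiagonalRectangle n → ℂ → M) (h0 : ∀ R, h R 0 = 0)
    (hadd : ∀ R a b, h R (a + b) = h R a + h R b) :
    (stepAdjoint p).sum h = p.sum fun R c => h R.reverse (starRingEnd ℂ c) := by
  rw [stepAdjoint, Finsupp.sum_sum_index h0 hadd]
  exact Finsupp.sum_congr fun R _ => Finsupp.sum_single_index (h0 _)

theorem stepFunction_stepAdjoint (p : OffDiagonalRectangle n →₀ ℂ) (x : Fin n → ℝ) :
    stepFunction (stepAdjoint p) x = starRingEnd ℂ (stepFunction p fun j => x j.rev) := by
  classical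
  rw [stepFunction, sum_stepAdjoint _ _ (by simp) (fun R a b => by
    by_cases h : x ∈ R.toSet <;> simp [h]), stepFunction, Finsupp.sum, Finsupp.sum, map_sum]
  refine Finset.sum_congr rfl fun R _ => ?_
  have h : x ∈ R.reverse.toSet ↔ (fun j => x j.rev) ∈ R.toSet := by
    simp only [OffDiagonalRectangle.toSet, OffDiagonalRectangle.reverse, Set.mem_univ_pi]
    exact ⟨fun h j => by simpa using h j.rev, fun h j => by simpa using h j.rev⟩
  by_cases hx : x ∈ R.reverse.toSet
  · rw [Set.indicator_of_mem hx, Set.indicator_of_mem (h.1 hx)]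
  · rw [Set.indicator_of_notMem hx, Set.indicator_of_notMem fun h' => hx (h.2 h'), map_zero]

theorem star_list_prod {A : Type*} [Monoid A] [StarMul A] (L : List A) :
    star L.prod = (L.reverse.map star).prod := by
  induction L with
  | nil => simp
  | cons a L ih => simp [ih]

theorem star_prod_ofFn {A : Type*} [Monoid A] [StarMul A] (x : Fin n → A)
    (hx : ∀ j, star (x j) = x j) :
    star (List.ofFn x).prod = (List.ofFn fun j => x j.rev).prod := by
  rw [star_list_prod]
  congr 1
  refine List.ext_getElem (by simp) fun k h1 h2 => ?_
  simp only [List.getElem_map, List.getElem_reverse, List.getElem_ofFn, hx]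
  congr 1
  ext
  simp [Fin.val_rev]
  omega

variable {H : Type*} [NormedAddCommGroup H] [InnerProductSpace ℂ H] [CompleteSpace H]
  {P : WStarProbabilitySpace H} {S : ℝ≥0 → P.Alg}

theorem IsFreeBrownianMotion.stepIntegral_stepAdjoint (hS : IsFreeBrownianMotion P S)
    (p : OffDiagonalRectangle n →₀ ℂ) :
    stepIntegral P S (stepAdjoint p) = star (stepIntegral P S p) := by
  rw [stepIntegral, sum_stepAdjoint _ _ (by simp) (fun R a b => add_smul _ _ _),
    stepIntegral, Finsupp.sum, Finsupp.sum, star_sum]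
  refine Finset.sum_congr rfl fun R _ => ?_
  rw [star_smul, star_prod_ofFn]
  · rfl
  · intro j
    rw [star_sub, (hS.isSelfAdjoint _).star_eq, (hS.isSelfAdjoint _).star_eq]

theorem tendsto_stepLp_iff (f : L2Orthant n) (p : ℕ → OffDiagonalRectangle n →₀ ℂ) :
    Tendsto (fun k => eLpNorm (fun x => f x - stepFunction (p k) x) 2 (orthantMeasure n))
      atTop (𝓝 0) ↔ Tendsto (fun k => stepLp n (p k)) atTop (𝓝 f) := by
  simp_rw [eLpNorm_sub_stepFunction]
  rw [tendsto_iff_norm_sub_tendsto_zero]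
  simp_rw [norm_sub_rev _ f]
  constructor
  · intro h
    have := (ENNReal.tendsto_toReal ENNReal.zero_ne_top).comp h
    simpa [Function.comp_def] using this
  · intro h
    simpa using ENNReal.tendsto_ofReal h

/-- Reversing the variables and conjugating preserves the `L²` norm and fixes `f`. -/
theorem tendsto_stepLp_stepAdjoint {f : L2Orthant n} (hf : MirrorSymmetric f)
    {p : ℕ → OffDiagonalRectangle n →₀ ℂ} (hp : Tendsto (fun k => stepLp n (p k)) atTop (𝓝 f)) :
    Tendsto (fun k => stepLp n (stepAdjoint (p k))) atTop (𝓝 f) := by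
  rw [← tendsto_stepLp_iff] at hp ⊢
  refine hp.congr fun k => ?_
  refine (eLpNorm_comp_measurePreserving
    ((Lp.aestronglyMeasurable f).sub (memLp_stepFunction (p k)).aestronglyMeasurable)
    (measurePreserving_rev n)).symm.trans ?_
  refine eLpNorm_congr_norm_ae ?_
  filter_upwards [hf] with x hx
  rw [hx, stepFunction_stepAdjoint, ← map_sub, RCLike.norm_conj]
  rfl

namespace IsFreeBrownianMotion

/-- By Haagerup's inequality, integrals converge in operator norm when the step functions
converge in `L²`. -/
theorem exists_tendsto_stepIntegral (hS : IsFreeBrownianMotion P S) {f : L2Orthant n}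
    {p : ℕ → OffDiagonalRectangle n →₀ ℂ} (hp : Tendsto (fun k => stepLp n (p k)) atTop (𝓝 f)) :
    ∃ Y : P.Alg, Tendsto (fun k => stepIntegral P S (p k)) atTop (𝓝 Y) := by
  have := P.completeSpace_alg
  refine cauchySeq_tendsto_of_complete ?_
  have hc := hp.cauchySeq
  rw [Metric.cauchySeq_iff] at hc ⊢
  intro ε hε
  have hn : (0 : ℝ) < n + 1 := by positivity
  obtain ⟨M, hM⟩ := hc (ε / (n + 1)) (by positivity)
  refine ⟨M, fun k hk l hl => ?_⟩
  have h := hM k hk l hl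
  rw [dist_eq_norm, ← map_sub] at h
  rw [dist_eq_norm, ← stepIntegral_sub]
  calc _ ≤ (n + 1) * ‖stepLp n (p k - p l)‖ := hS.norm_stepIntegral_le _
    _ < (n + 1) * (ε / (n + 1)) := by gcongr
    _ = ε := by field_simp

/-- Step integrals of `L²`-convergent step functions converge in operator norm, and by faithfulness
their norm limit is the `L²` limit `X`. -/
theorem isWignerIntegral_iff (hS : IsFreeBrownianMotion P S) (f : L2Orthant n) (X : P.Alg) :
    IsWignerIntegral P S f X ↔ ∃ p : ℕ → OffDiagonalRectangle n →₀ ℂ,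
      Tendsto (fun k => stepLp n (p k)) atTop (𝓝 f) ∧
      Tendsto (fun k => stepIntegral P S (p k)) atTop (𝓝 X) := by
  have hcont : ∀ (p : ℕ → OffDiagonalRectangle n →₀ ℂ) (Y : P.Alg),
      Tendsto (fun k => stepIntegral P S (p k)) atTop (𝓝 Y) →
      Tendsto (fun k => P.norm₂ (X - stepIntegral P S (p k))) atTop (𝓝 (P.norm₂ (X - Y))) :=
    fun p Y h => (P.continuous_norm₂.tendsto _).comp (h.const_sub X)
  constructor
  · rintro ⟨p, hp, h⟩
    rw [tendsto_stepLp_iff] at hp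
    obtain ⟨Y, hY⟩ := hS.exists_tendsto_stepIntegral hp
    have h0 := tendsto_nhds_unique h (hcont p Y hY)
    rw [sub_eq_zero.1 (P.eq_zero_of_norm₂ _ h0.symm)]
    exact ⟨p, hp, hY⟩
  · rintro ⟨p, hp, h⟩
    refine ⟨p, (tendsto_stepLp_iff f p).2 hp, ?_⟩
    have := hcont p X h
    rwa [sub_self, ← P.norm_toL2, map_zero, norm_zero] at this

theorem isWignerIntegral_unique (hS : IsFreeBrownianMotion P S) {f : L2Orthant n} {X Y : P.Alg}
    (hX : IsWignerIntegral P S f X) (hY : IsWignerIntegral P S f Y) : X = Y := by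
  rw [hS.isWignerIntegral_iff] at hX hY
  obtain ⟨p, hp, hpX⟩ := hX
  obtain ⟨q, hq, hqY⟩ := hY
  have h1 := (hpX.sub hqY).norm
  have h2 := ((hp.sub hq).norm).const_mul ((n : ℝ) + 1)
  rw [sub_self, norm_zero, mul_zero] at h2
  have h3 : ‖X - Y‖ ≤ 0 := le_of_tendsto_of_tendsto' h1 h2 fun k => by
    rw [← stepIntegral_sub, ← map_sub]
    exact hS.norm_stepIntegral_le _
  exact sub_eq_zero.1 (norm_le_zero_iff.1 h3)

theorem exists_isWignerIntegral (hS : IsFreeBrownianMotion P S) (f : L2Orthant n) :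
    ∃ X : P.Alg, IsWignerIntegral P S f X := by
  obtain ⟨y, hy, hyf⟩ := mem_closure_iff_seq_limit.1 (denseRange_stepLp n f)
  choose p hp using hy
  obtain rfl : (fun k => stepLp n (p k)) = y := funext hp
  obtain ⟨X, hX⟩ := hS.exists_tendsto_stepIntegral hyf
  exact ⟨X, (hS.isWignerIntegral_iff f X).2 ⟨p, hyf, hX⟩⟩

theorem isSelfAdjoint_of_mirrorSymmetric (hS : IsFreeBrownianMotion P S) {f : L2Orthant n}
    (hf : MirrorSymmetric f) {X : P.Alg} (hX : IsWignerIntegral P S f X) : IsSelfAdjoint X := by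
  refine hS.isWignerIntegral_unique ?_ hX
  rw [hS.isWignerIntegral_iff] at hX ⊢
  obtain ⟨p, hp, hpX⟩ := hX
  refine ⟨fun k => stepAdjoint (p k), tendsto_stepLp_stepAdjoint hf hp, ?_⟩
  simp_rw [hS.stepIntegral_stepAdjoint]
  exact hpX.star

theorem map_wignerIntegral (hS : IsFreeBrownianMotion P S) (hn : n ≠ 0) {f : L2Orthant n}
    {X : P.Alg} (hX : IsWignerIntegral P S f X) : P.φ X = 0 := by
  obtain ⟨p, -, hpX⟩ := (hS.isWignerIntegral_iff f X).1 hX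
  refine tendsto_nhds_unique ((P.continuous_φ.tendsto X).comp hpX) ?_
  simp [Function.comp_def, hS.map_stepIntegral hn]

/-- A rectangle not orthogonal to `f` is fixed before the limit is taken, so the lower bound for the
excess converges to a positive number. -/
theorem two_mul_norm₂_pow_four_lt (hS : IsFreeBrownianMotion P S) (hn : 2 ≤ n) {f : L2Orthant n}
    (hf : f ≠ 0) {X : P.Alg} (hX : IsWignerIntegral P S f X) :
    2 * (P.norm₂ X ^ 2) ^ 2 < P.norm₂ (X * star X) ^ 2 := by
  obtain ⟨p, hp, hpX⟩ := (hS.isWignerIntegral_iff f X).1 hX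
  obtain ⟨R, hR⟩ : ∃ R, ⟪stepLp n (Finsupp.single R 1), f⟫_ℂ ≠ 0 := by
    by_contra! h
    exact hf (eq_zero_of_forall_inner_stepLp f h)
  have h1 := ((tendsto_const_nhds (x := stepLp n (Finsupp.single R 1))).inner
    (𝕜 := ℂ) hp).norm.pow 4
  have h2 : Tendsto (fun k => ‖stepLp n (p k)‖) atTop (𝓝 (P.norm₂ X)) := by
    simp_rw [← hS.norm₂_stepIntegral]
    exact (P.continuous_norm₂.tendsto X).comp hpX
  have h3 : Tendsto (fun k => P.norm₂ (stepIntegral P S (p k) * star (stepIntegral P S (p k))))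
      atTop (𝓝 (P.norm₂ (X * star X))) :=
    (P.continuous_norm₂.tendsto _).comp (hpX.mul hpX.star)
  have h4 := le_of_tendsto_of_tendsto' h1
    (((h3.pow 2).sub (((h2.pow 2).pow 2).const_mul 2)).const_mul
      ((‖stepLp n (Finsupp.single R 1)‖ ^ 2) ^ 2))
    fun k => hS.norm_inner_pow_four_le hn (p k) R
  have h5 := (pow_pos (norm_pos_iff.2 hR) 4).trans_le h4
  exact sub_pos.1 (pos_of_mul_pos_right h5 (by positivity))

end IsFreeBrownianMotion

end

end FreeProb

end

theorem corollary1p7 {H : Type*} [NormedAddCommGroup H] [InnerProductSpace ℂ H] [CompleteSpace H]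
    (P : FreeProb.WStarProbabilitySpace H) (S : ℝ≥0 → P.Alg)
    (hS : FreeProb.IsFreeBrownianMotion P S)
    (n : ℕ) (hn : 2 ≤ n) (f : FreeProb.L2Orthant n) (hf : f ≠ 0)
    (hsymm : FreeProb.MirrorSymmetric f) :
    (∃! X : P.Alg, FreeProb.IsWignerIntegral P S f X) ∧
    ∀ X : P.Alg, FreeProb.IsWignerIntegral P S f X →
      IsSelfAdjoint X ∧
      2 * P.φ (X ^ 2) ^ 2 < P.φ (X ^ 4) ∧
      ∀ a v : ℝ, 0 < v → ¬ FreeProb.IsLaw P X (FreeProb.semicircular a v) := by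
  obtain ⟨X₀, hX₀⟩ := hS.exists_isWignerIntegral f
  refine ⟨⟨X₀, hX₀, fun Y hY => hS.isWignerIntegral_unique hY hX₀⟩, fun X hX => ?_⟩
  have hsa := hS.isSelfAdjoint_of_mirrorSymmetric hsymm hX
  have hlt : 2 * P.φ (X ^ 2) ^ 2 < P.φ (X ^ 4) := by
    have h2 : X ^ 2 = star X * X := by rw [hsa.star_eq, sq]
    have h4 : X ^ 4 = star (X * star X) * (X * star X) := by
      rw [hsa.star_eq, star_mul, hsa.star_eq]; noncomm_ring
    rw [h2, h4, P.φ_star_mul_self, P.φ_star_mul_self]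
    exact_mod_cast hS.two_mul_norm₂_pow_four_lt hn hf hX
  refine ⟨hsa, hlt, fun a v hv hlaw => ?_⟩
  obtain ⟨h1, h4⟩ := hlaw.moments hv
  -- The integral is centred, so `a = 0` and the semicircular fourth moment identity contradicts
  -- `hlt`.
  rw [hS.map_wignerIntegral (by omega) hX] at h1
  exact hlt.ne' (h4 (by exact_mod_cast h1.symm))
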